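/- Let $N\ge 5$ be odd. All Hilbert spaces are finite-dimensional complex, of arbitrary dimension, indices $i\in\{1,\dots,N\}$ are cyclic ($N+1=1$), and $\|X\|=\operatorname{tr}\sqrt{X^\dagger X}$ is the trace norm. A quantum strategy $\mathcal S=(\rho,\{\Pi_i\}_{i=1}^N)$ consists of a density operator $\rho$ and orthogonal projectors $\Pi_i$ such that $\Pi_i$ and $\Pi_{i+1}$ are compatible (commute) for all $i$. The measurement $i$ has outcomes $a\in\{0,1\}$ with projectors $M_{1|i}=\Pi_i$ and $M_{0|i}=\mathbb 1-\Pi_i$. With $p(a|i)=\operatorname{tr}(M_{a|i}\rho)$ and $p(a,b|i,j)=\operatorname{tr}(M_{b|j}M_{a|i}\rho M_{a|i})$, the value of the strategy is $\beta(\mathcal S)=\sum_{i=1}^N p(1,0|i,i+1)$, and $\beta_{\mathrm{QT}}$ is the maximum (supremum) of $\beta$ over all quantum strategies in all finite dimensions. The ideal strategy on $\mathbb C^3$ is $|v_0\rangle=(1,0,0)^T$, $\Pi_i=|v_i\rangle\langle v_i|$, $|v_i\rangle=(\cos\theta,\sin\theta\sin\phi_i,\sin\theta\cos\phi_i)^T$,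 with $\theta\in(0,\pi/2)$, $\cos^2\theta=\frac{\cos(\pi/N)}{1+\cos(\pi/N)}$ and $\phi_i=\frac{i\pi(N-1)}{N}$. Let $p(a|i)$ be its outcome probabilities and $|a_i\rangle\langle a_i|=M_{a|i}|v_0\rangle\langle v_0|M_{a|i}/p(a|i)$ its post-measurement states; $|0_i\rangle\perp|1_i\rangle$. Then there are constants $C>0$ and $\epsilon_0>0$, depending only on $N$, such that the following holds for every $0\le\epsilon\le\epsilon_0$. Let $\tilde{\mathcal S}=(\tilde\rho_A,\{\tilde\Pi_i=|\tilde v_i\rangle\langle\tilde v_i|_A\}_{i=1}^N)$ be any quantum strategy of Alice with rank-one projectors and $\beta(\tilde{\mathcal S})=\beta_{\mathrm{QT}}-\epsilon$, and let $|\psi\rangle_{AE}$ be any purification of $\tilde\rho_A$, with $E$ held by Eve. For each $i$ let $$\rho_{AE}^{(i)}=\sum_{a=0}^1|a_i\rangle\langle a_i|_A\otimes\operatorname{tr}_A\!\big[(\tilde M_{a|i}\otimes\mathbb 1_E)|\psi\rangle\langle\psi|_{AE}\big]$$ be the single-round post-measurement classical-quantum state of Alice and Eve, $\tilde M_{1|i}=\tilde\Pi_i$,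 $\tilde M_{0|i}=\mathbb 1-\tilde\Pi_i$, with Alice's outcome stored in the orthonormal states $|a_i\rangle$. Then there is a unit vector $|\xi\rangle_E$, the same for all $i$, such that for all $i=1,\dots,N$ $$\Big\|\rho_{AE}^{(i)}-\sum_{a=0}^1p(a|i)\,|a_i\rangle\langle a_i|_A\otimes|\xi\rangle\langle\xi|_E\Big\|\le C\sqrt\epsilon .$$ -/

import Mathlib

open scoped Matrix Kronecker

namespace Cycle

noncomputable section

/-- The operator `|v⟩⟨v|`. -/
def ketbra {n : Type*} (v : n → ℂ) : Matrix n n ℂ := Matrix.vecMulVec v (star v)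

open scoped MatrixOrder ComplexOrder Matrix.Norms.L2Operator in
/-- The trace norm `‖A‖ = tr √(A† A)`. -/
def traceNorm {n : Type*} [Fintype n] [DecidableEq n] (A : Matrix n n ℂ) : ℝ :=
  (CFC.sqrt (Aᴴ * A)).trace.re

/-- Partial trace over the first tensor factor. -/
def traceFst {m n : Type*} [Fintype m] (X : Matrix (m × n) (m × n) ℂ) : Matrix n n ℂ :=
  Matrix.of fun k l => ∑ x, X (x, k) (x, l)

/-- Partial trace over the second tensor factor. -/
def traceSnd {m n : Type*} [Fintype n] (X : Matrix (m × n) (m × n) ℂ) : Matrix m m ℂ :=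
  Matrix.of fun x y => ∑ k, X (x, k) (y, k)

/-- The data of a strategy for the `N`-cycle on `ℂ^d`: a state `ρ` and operators
`Π i`, one for each vertex of the cycle. -/
structure Strategy (N d : ℕ) where
  /-- the state -/
  ρ : Matrix (Fin d) (Fin d) ℂ
  /-- the projectors -/
  P : Fin N → Matrix (Fin d) (Fin d) ℂ

namespace Strategy

variable {N d : ℕ} (S : Strategy N d)

open scoped ComplexOrder in
/-- `S` is a quantum strategy: `ρ` is a density operator, the `Π i` are projectors, and projectors
at neighbouring vertices `i`, `i + 1` (cyclically) are compatible, that is, they commute. -/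
structure IsQuantum : Prop where
  posSemidef : S.ρ.PosSemidef
  trace_eq_one : S.ρ.trace = 1
  isHermitian : ∀ i, (S.P i).IsHermitian
  idempotent : ∀ i, S.P i * S.P i = S.P i
  compatible : ∀ i, Commute (S.P i) (S.P (finRotate N i))

/-- Every `Π i` is of the form `|v⟩⟨v|` with a unit vector `v`. -/
def IsRankOne : Prop :=
  ∀ i, ∃ v : Fin d → ℂ, star v ⬝ᵥ v = 1 ∧ S.P i = ketbra v

/-- The projector of outcome `a` of measurement `i`: `Π i` for the outcome `1` and
`1 - Π i` for the outcome `0`. -/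
def M (a : Fin 2) (i : Fin N) : Matrix (Fin d) (Fin d) ℂ :=
  if a = 1 then S.P i else 1 - S.P i

/-- The probability `p(a|i)` of outcome `a` of measurement `i`. -/
def prob (a : Fin 2) (i : Fin N) : ℝ := (S.M a i * S.ρ).trace.re

/-- The state after an ideal measurement of `Π i` with outcome `a`. -/
def post (a : Fin 2) (i : Fin N) : Matrix (Fin d) (Fin d) ℂ :=
  (S.prob a i)⁻¹ • (S.M a i * S.ρ * S.M a i)

/-- The probability `p(a,b|i,j)` of outcomes `a` and `b` when measurement `i` is followed by
measurement `j` on the post-measurement state. -/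
def prob₂ (a b : Fin 2) (i j : Fin N) : ℝ :=
  (S.M b j * (S.M a i * S.ρ * S.M a i)).trace.re

/-- The value `β = ∑ i, p(1,0|i,i+1)`, indices being cyclic. -/
def beta : ℝ := ∑ i, S.prob₂ 1 0 i (finRotate N i)

end Strategy

/-- The maximal quantum value of `β` for the `N`-cycle, over all finite dimensions. -/
def betaQT (N : ℕ) : ℝ :=
  sSup {b | ∃ (d : ℕ) (S : Strategy N d), S.IsQuantum ∧ S.beta = b}

/-- `cos² θ = cos (π / N) / (1 + cos (π / N))`. -/
def cosSq (N : ℕ) : ℝ := Real.cos (Real.pi / N) / (1 + Real.cos (Real.pi / N))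

/-- The angle `φ = j π (N - 1) / N` of the vertex with label `j = 1, …, N`; the vertex `i : Fin N`
carries the label `i + 1`. -/
def angle (N : ℕ) (i : Fin N) : ℝ := ((i : ℝ) + 1) * Real.pi * ((N : ℝ) - 1) / N

/-- The state vector of the optimal strategy. -/
def idealVec₀ : Fin 3 → ℂ := ![1, 0, 0]

/-- The measurement vectors `(cos θ, sin θ sin φ, sin θ cos φ)` of the optimal strategy. -/
def idealVec (N : ℕ) (i : Fin N) : Fin 3 → ℂ :=
  ![((√(cosSq N) : ℝ) : ℂ),
    ((√(1 - cosSq N) * Real.sin (angle N i) : ℝ) : ℂ),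
    ((√(1 - cosSq N) * Real.cos (angle N i) : ℝ) : ℂ)]

/-- The optimal strategy of the odd `N`-cycle. -/
def ideal (N : ℕ) : Strategy N 3 where
  ρ := ketbra idealVec₀
  P i := ketbra (idealVec N i)

/-- Eve's (unnormalized) state conditioned on Alice's outcome `a` of measurement `i`, when Alice and
Eve share the state `|ψ⟩`: `tr_A [(M_a ⊗ 1) |ψ⟩⟨ψ|]`. -/
def eveState {N dA dE : ℕ} (S : Strategy N dA) (ψ : Fin dA × Fin dE → ℂ) (a : Fin 2) (i : Fin N) :
    Matrix (Fin dE) (Fin dE) ℂ :=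
  traceFst ((S.M a i ⊗ₖ (1 : Matrix (Fin dE) (Fin dE) ℂ)) * ketbra ψ)

/-- The post-measurement classical-quantum state of Alice and Eve for measurement `i`,
`∑ a, |a_i⟩⟨a_i| ⊗ tr_A [(M_a ⊗ 1) |ψ⟩⟨ψ|]`, where the outcome `a` is held in the register state
`|a_i⟩⟨a_i|`, the corresponding (pure) post-measurement state of the optimal strategy. -/
def postState {N dA dE : ℕ} (S : Strategy N dA) (ψ : Fin dA × Fin dE → ℂ) (i : Fin N) :
    Matrix (Fin 3 × Fin dE) (Fin 3 × Fin dE) ℂ :=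
  ∑ a : Fin 2, (ideal N).post a i ⊗ₖ eveState S ψ a i

/-- The uncorrelated state `∑ a, p(a|i) |a_i⟩⟨a_i| ⊗ |ξ⟩⟨ξ|`, where `p(a|i)` and `|a_i⟩⟨a_i|` are
the outcome probabilities and post-measurement states of the optimal strategy. -/
def productState (N : ℕ) {dE : ℕ} (ξ : Fin dE → ℂ) (i : Fin N) :
    Matrix (Fin 3 × Fin dE) (Fin 3 × Fin dE) ℂ :=
  (∑ a : Fin 2, (ideal N).prob a i • (ideal N).post a i) ⊗ₖ ketbra ξ

end

end Cycle

/-!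
Write `c = cos (π / N)`, `κ = cosSq N = c / (1 + c)`, and let `Ψ` be the purification read as a
`dA × dE` matrix, so that `Ψ Ψᴴ = ρ` and Eve's conditional states are the transposes of `Ψᴴ M Ψ`.

*Reduction.* For any quantum strategy the operators `Q i = Π i (1 - Π (i + 1))` are projections,
cyclic neighbours are orthogonal, and `β = ∑ i, tr (Q i ρ)`.

*Sum of squares.* On functions on `ℤ / N` the form
`r i = u (i + 1) + u (i - 1) + 2 c u i - ((2 + 2 c) / N) ∑ j, u j` is diagonal in the Fourier basis
with eigenvalues in `[0, 4]`; this is the Lovász certificate for the odd cycle. For `u i = Q i Ψ`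
the orthogonality of neighbours turns it into `‖∑ i, u i‖² ≤ N κ β` (`IsCycleProj.norm_sum_sq_le`),
hence `β ≤ N κ`, a value that the ideal strategy attains. If `β ≥ N κ - ε`, then all `r i` and
`∑ i, u i - N κ Ψ` have norm `O(√ε)`, which combines to the approximate recurrence
`u (i + 1) + u (i - 1) + 2 c u i ≈ 2 c Ψ` (`IsCycleProj.norm_recurrence_le`).

*Rigidity.* Put `D i = Ψᴴ u i = (u i)ᴴ u i`. Multiplying the recurrence around `i + 1` by `(u i)ᴴ`
and by `(u (i + 2))ᴴ` gives `(u i)ᴴ u (i + 2) ≈ (2 c - 1) D i` and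
`(u (i + 2))ᴴ u i ≈ (2 c - 1) D (i + 2)`. The left sides are adjoint to each other and `D` is
Hermitian; as `2 c > 1` for `N ≥ 5`, this yields `D i ≈ D (i + 2)`, and as `N` is odd all `D i`
agree approximately. Multiplying by `Ψᴴ` finally gives `D i ≈ κ Ψᴴ Ψ`
(`IsCycleProj.frameNorm_sub_cosSq_smul_le`). Errors are measured by the sums
`∑ j, |(Fᴴ A F) j j|` over a Parseval frame `F`, which for `A = Xᴴ Y` are at most the product of the
Hilbert-Schmidt norms of `X` and `Y` and, for a suitable `F`, compute the trace norm.

*Conclusion.* By rigidity `Q i ≠ 0`, and `Π i` has rank one, so `Q i = Π i`. Then `D i` has rank one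
as well, and since `D i ≈ κ Ψᴴ Ψ` both of Eve's conditional states are close to multiples of the
normalized `D 0`.
-/

namespace Cycle

/-! ### Fourier analysis of the sum-of-squares form on the cycle -/

open ZMod AddChar in
/-- Plancherel's formula for the discrete Fourier transform. -/
theorem sum_conj_dft_mul_dft {N : ℕ} [NeZero N] (f g : ZMod N → ℂ) :
    ∑ k, star (dft f k) * dft g k = N * ∑ j, star (f j) * g j := by
  have hconj (x : ZMod N) : star (stdAddChar (-x)) = stdAddChar x := by
    rw [AddChar.map_neg_eq_conj]; simp
  have hinv (j : ZMod N) : ∑ k, stdAddChar (j * k) * dft g k = N * g j := by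
    have h := congrFun (dft.symm_apply_apply g) j
    rw [invDFT_apply] at h
    simp only [smul_eq_mul] at h
    have hN : (N : ℂ) ≠ 0 := NeZero.ne _
    rw [← h]
    simp only [mul_comm j]
    field_simp
  simp_rw [Finset.mul_sum, dft_apply f, star_sum, Finset.sum_mul]
  rw [Finset.sum_comm]
  refine Finset.sum_congr rfl fun j _ => ?_
  rw [mul_left_comm, ← hinv, Finset.mul_sum]
  refine Finset.sum_congr rfl fun k _ => ?_
  rw [smul_eq_mul, star_mul', hconj]
  ring

open ZMod AddChar in
theorem dft_shift {N : ℕ} [NeZero N] (f : ZMod N → ℂ) (a k : ZMod N) :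
    dft (fun j => f (j + a)) k = stdAddChar (a * k) * dft f k := by
  rw [dft_apply, dft_apply, Finset.mul_sum]
  refine Fintype.sum_equiv (Equiv.addRight a) _ _ fun j => ?_
  simp only [Equiv.coe_addRight, smul_eq_mul, ← mul_assoc, ← AddChar.map_add_eq_mul]
  congr 2
  ring

open ZMod AddChar in
theorem dft_const {N : ℕ} [NeZero N] (z : ℂ) (k : ZMod N) :
    dft (fun _ : ZMod N => z) k = if k = 0 then N * z else 0 := by
  have h := AddChar.sum_mulShift k (isPrimitive_stdAddChar N)
  rw [dft_apply]
  simp only [smul_eq_mul, ← Finset.sum_mul]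
  rw [← Equiv.sum_comp (Equiv.neg (ZMod N))]
  simp only [Equiv.neg_apply, neg_mul, neg_neg, h, ZMod.card]
  split_ifs <;> simp

/-- The operator `f ↦ (f (i + 1) + f (i - 1) + 2 c f i - (2 + 2 c) m)ᵢ` on cyclic sequences, where
`m` is the mean of `f`. For `c = cos (π / N)` it is a multiple of the optimal dual
solution `ϑ 1 + t A - J` of the Lovász semidefinite program of the odd cycle with adjacency matrix `A`. -/
noncomputable def dualOp {N : ℕ} {V : Type*} [AddCommGroup V] [Module ℝ V] [NeZero N] (c : ℝ)
    (f : ZMod N → V) (i : ZMod N) : V :=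
  f (i + 1) + f (i - 1) + (2 * c) • f i - ((2 + 2 * c) / N) • ∑ j, f j

/-- The eigenvalue of `dualOp (cos (π / N))` at the frequency `k`. It vanishes at `k = 0`, where the
mean is subtracted. -/
noncomputable def dualEig (N : ℕ) [NeZero N] (k : ZMod N) : ℝ :=
  if k = 0 then 0 else 2 * Real.cos (Real.pi / N) + 2 * Real.cos (2 * Real.pi * k.val / N)

theorem dualEig_le (N : ℕ) [NeZero N] (k : ZMod N) : dualEig N k ≤ 4 := by
  unfold dualEig
  split_ifs
  · norm_num
  · linarith [Real.cos_le_one (Real.pi / N), Real.cos_le_one (2 * Real.pi * k.val / N)]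

/-- For odd `N`, the smallest value of `cos (2 π k / N)` is `-cos (π / N)`. After the sum of cosines
is written as a product, both factors are nonnegative for `2 k < N` and nonpositive for
`2 k > N`. -/
theorem dualEig_nonneg {N : ℕ} [NeZero N] (hodd : Odd N) (k : ZMod N) : 0 ≤ dualEig N k := by
  unfold dualEig
  split_ifs with h
  · exact le_rfl
  have hN : (0 : ℝ) < N := by exact_mod_cast NeZero.pos N
  have hk1 : 1 ≤ k.val := by
    rcases Nat.eq_zero_or_pos k.val with h0 | h0
    · exact absurd ((ZMod.val_eq_zero k).1 h0) h
    · exact h0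
  have hk2 : k.val + 1 ≤ N := ZMod.val_lt k
  set m := k.val
  have key : 2 * Real.cos (Real.pi / N) + 2 * Real.cos (2 * Real.pi * m / N) =
      4 * (Real.cos (Real.pi * (2 * m + 1) / (2 * N)) *
        Real.cos (Real.pi * (2 * m - 1) / (2 * N))) := by
    rw [← mul_add, add_comm, Real.cos_add_cos]
    have e1 : (2 * Real.pi * m / N + Real.pi / N) / 2 = Real.pi * (2 * m + 1) / (2 * N) := by
      field_simp
    have e2 : (2 * Real.pi * m / N - Real.pi / N) / 2 = Real.pi * (2 * m - 1) / (2 * N) := by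
      field_simp
    rw [e1, e2]; ring
  rw [key]
  have hm1 : (1 : ℝ) ≤ m := by exact_mod_cast hk1
  have hm2 : (m : ℝ) + 1 ≤ N := by exact_mod_cast hk2
  have hpi := Real.pi_pos
  refine mul_nonneg (by norm_num) ?_
  rcases Nat.lt_or_ge (2 * m) N with hlt | hge
  · have h1 : (2 * m + 1 : ℝ) ≤ N := by exact_mod_cast hlt
    refine mul_nonneg (Real.cos_nonneg_of_mem_Icc ⟨?_, ?_⟩) (Real.cos_nonneg_of_mem_Icc ⟨?_, ?_⟩)
    · have : 0 ≤ Real.pi * (2 * m + 1) / (2 * N) := by positivity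
      linarith
    · rw [div_le_div_iff₀ (by positivity) (by positivity)]; nlinarith
    · have : 0 ≤ Real.pi * (2 * m - 1) / (2 * N) :=
        div_nonneg (mul_nonneg hpi.le (by linarith)) (by positivity)
      linarith
    · rw [div_le_div_iff₀ (by positivity) (by positivity)]; nlinarith
  · have hne : 2 * m ≠ N := fun h => by
      obtain ⟨t, ht⟩ := hodd; omega
    have h1 : (N + 1 : ℝ) ≤ 2 * m := by exact_mod_cast (by omega : N + 1 ≤ 2 * m)
    refine mul_nonneg_of_nonpos_of_nonpos (Real.cos_nonpos_of_pi_div_two_le_of_le ?_ ?_)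
      (Real.cos_nonpos_of_pi_div_two_le_of_le ?_ ?_)
    · rw [div_le_div_iff₀ (by positivity) (by positivity)]; nlinarith
    · rw [div_le_iff₀ (by positivity)]; nlinarith
    · rw [div_le_div_iff₀ (by positivity) (by positivity)]; nlinarith
    · rw [div_le_iff₀ (by positivity)]; nlinarith

open ZMod AddChar in
theorem dft_dualOp {N : ℕ} [NeZero N] (f : ZMod N → ℂ) (k : ZMod N) :
    dft (dualOp (Real.cos (Real.pi / N)) f) k = dualEig N k * dft f k := by
  set c := Real.cos (Real.pi / N)
  have hN : (N : ℂ) ≠ 0 := NeZero.ne _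
  have hsplit : dualOp c f = ((fun j => f (j + 1)) + fun j => f (j + -1)) + ((2 * c : ℝ) : ℂ) • f -
      fun _ => (((2 + 2 * c) / N : ℝ) : ℂ) * ∑ j, f j := by
    ext j
    simp [dualOp, sub_eq_add_neg]
  rw [hsplit, map_sub, map_add, map_add, _root_.map_smul]
  simp only [Pi.sub_apply, Pi.add_apply, Pi.smul_apply, smul_eq_mul, dft_shift, dft_const, one_mul,
    neg_mul]
  unfold dualEig
  split_ifs with h
  · subst h
    rw [dft_apply_zero]
    simp
    field_simp
    ring
  · have hcos : stdAddChar k + stdAddChar (-k) =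
        ((2 * Real.cos (2 * Real.pi * k.val / N) : ℝ) : ℂ) := by
      have h1 := stdAddChar_coe (N := N) (k.val : ℤ)
      have h2 := stdAddChar_coe (N := N) (-(k.val : ℤ))
      simp only [Int.cast_neg, Int.cast_natCast, ZMod.natCast_zmod_val] at h1 h2
      rw [h1, h2]
      push_cast
      rw [Complex.cos, mul_div_cancel₀ _ two_ne_zero]
      congr 2 <;> ring
    push_cast [c] at hcos ⊢
    linear_combination dft f k * hcos

/-- The eigenvalues of `dualOp` lie in `[0, 4]`, so its square is at most `4` times itself. -/
theorem sum_norm_sq_dualOp_le {N : ℕ} [NeZero N] (hodd : Odd N) (f : ZMod N → ℂ) :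
    ∑ i, ‖dualOp (Real.cos (Real.pi / N)) f i‖ ^ 2 ≤
      4 * (∑ i, star (f i) * dualOp (Real.cos (Real.pi / N)) f i).re := by
  set r := dualOp (Real.cos (Real.pi / N)) f with hr
  have hN : (0 : ℝ) < N := by exact_mod_cast NeZero.pos N
  have h1 := sum_conj_dft_mul_dft r r
  have h2 := sum_conj_dft_mul_dft f r
  have hsq (z : ℂ) : (star z * z) = ((‖z‖ ^ 2 : ℝ) : ℂ) := by
    rw [mul_comm]; simpa using Complex.mul_conj' z
  have h1' : ∑ k, (dualEig N k) ^ 2 * ‖ZMod.dft f k‖ ^ 2 = N * ∑ i, ‖r i‖ ^ 2 := by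
    simp only [hsq] at h1
    rw [← Complex.ofReal_inj]
    push_cast at h1 ⊢
    rw [← h1]
    refine Finset.sum_congr rfl fun k _ => ?_
    rw [hr, dft_dualOp, norm_mul]
    simp [mul_pow, ← Complex.ofReal_pow]
  have h2' : ∑ k, dualEig N k * ‖ZMod.dft f k‖ ^ 2 = N * (∑ i, star (f i) * r i).re := by
    have := congrArg Complex.re h2
    rw [← Complex.ofReal_natCast, Complex.re_ofReal_mul] at this
    rw [← this, Complex.re_sum]
    refine Finset.sum_congr rfl fun k _ => ?_
    rw [hr, dft_dualOp, mul_left_comm, hsq, ← Complex.ofReal_mul, Complex.ofReal_re]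
  refine le_of_mul_le_mul_left ?_ hN
  rw [← h1', mul_left_comm, ← h2', Finset.mul_sum]
  refine Finset.sum_le_sum fun k _ => ?_
  nlinarith [mul_nonneg (mul_nonneg (dualEig_nonneg hodd k) (sub_nonneg.2 (dualEig_le N k)))
    (sq_nonneg ‖ZMod.dft f k‖)]

/-! ### The constants `cos (π / N)` and `cosSq N` -/

theorem cos_pi_div_nonneg {N : ℕ} (hN : 2 ≤ N) : 0 ≤ Real.cos (Real.pi / N) := by
  have h2 : (2 : ℝ) ≤ N := by exact_mod_cast hN
  refine Real.cos_nonneg_of_mem_Icc ⟨?_, ?_⟩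
  · linarith [Real.pi_pos, (by positivity : 0 ≤ Real.pi / N)]
  · exact div_le_div_of_nonneg_left Real.pi_pos.le (by norm_num) h2

theorem cosSq_mul (N : ℕ) (hN : 2 ≤ N) :
    cosSq N * (1 + Real.cos (Real.pi / N)) = Real.cos (Real.pi / N) := by
  have := cos_pi_div_nonneg hN
  unfold cosSq
  field_simp

theorem half_lt_cos_pi_div {N : ℕ} (hN : 5 ≤ N) : 1 / 2 < Real.cos (Real.pi / N) := by
  have h5 : (5 : ℝ) ≤ N := by exact_mod_cast hN
  rw [← Real.cos_pi_div_three]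
  have hpi := Real.pi_pos
  refine Real.cos_lt_cos_of_nonneg_of_le_pi (by positivity) (by linarith) ?_
  exact div_lt_div_of_pos_left hpi (by norm_num) (by linarith)

theorem cosSq_pos_and_lt_one {N : ℕ} (hN : 5 ≤ N) : 0 < cosSq N ∧ cosSq N < 1 := by
  have h := half_lt_cos_pi_div hN
  constructor
  · unfold cosSq; positivity
  · unfold cosSq; rw [div_lt_one (by linarith)]; linarith

/-! ### Parseval frames and a dual form of the trace norm -/

section Frobenius

open scoped Matrix.Norms.Frobenius

theorem frobenius_norm_sq {m n : Type*} [Fintype m] [Fintype n] (X : Matrix m n ℂ) :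
    ‖X‖ ^ 2 = ∑ a, ∑ b, ‖X a b‖ ^ 2 := by
  rw [Matrix.frobenius_norm_def, ← Real.rpow_natCast, ← Real.rpow_mul (by positivity)]
  norm_num

theorem trace_conjTranspose_mul_self {m n : Type*} [Fintype m] [Fintype n] (X : Matrix m n ℂ) :
    (Xᴴ * X).trace = ((‖X‖ ^ 2 : ℝ) : ℂ) := by
  rw [frobenius_norm_sq, Finset.sum_comm]
  simp only [Matrix.trace, Matrix.diag, Matrix.mul_apply, Matrix.conjTranspose_apply]
  push_cast
  refine Finset.sum_congr rfl fun b _ => Finset.sum_congr rfl fun a _ => ?_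
  rw [mul_comm]; simpa using Complex.mul_conj' (X a b)

/-- The sum of the moduli of the diagonal entries of `Fᴴ A F`. When the columns of `F` form a
Parseval frame, `F * Fᴴ = 1`, this is a lower bound for the trace norm of `A`; the eigenbasis of a
Hermitian `A` gives equality. Frames that are not bases occur as compressions of bases of a tensor
product. -/
noncomputable def frameNorm {n ι : Type*} [Fintype n] [Fintype ι] (F : Matrix n ι ℂ)
    (A : Matrix n n ℂ) : ℝ :=
  ∑ i, ‖(Fᴴ * A * F) i i‖

theorem map_star_mul_conjTranspose {n ι : Type*} [Fintype ι] [DecidableEq n]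
    {F : Matrix n ι ℂ} (hF : F * Fᴴ = 1) :
    F.map star * (F.map star)ᴴ = 1 := by
  have h1 : (F.map star)ᴴ = Fᵀ := by ext; simp
  have h2 : F.map star = (Fᴴ)ᵀ := rfl
  rw [h1, h2, ← Matrix.transpose_mul, hF, Matrix.transpose_one]

section frameNorm

variable {n ι : Type*} [Fintype n] [Fintype ι] (F : Matrix n ι ℂ)

theorem frameNorm_nonneg (A : Matrix n n ℂ) : 0 ≤ frameNorm F A :=
  Finset.sum_nonneg fun _ _ => norm_nonneg _

theorem frameNorm_add_le (A B : Matrix n n ℂ) :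
    frameNorm F (A + B) ≤ frameNorm F A + frameNorm F B := by
  simp only [frameNorm, ← Finset.sum_add_distrib]
  refine Finset.sum_le_sum fun i _ => ?_
  rw [Matrix.mul_add, Matrix.add_mul, Matrix.add_apply]
  exact norm_add_le _ _

theorem frameNorm_smul (r : ℝ) (A : Matrix n n ℂ) :
    frameNorm F (r • A) = |r| * frameNorm F A := by
  simp [frameNorm, Finset.mul_sum]

theorem frameNorm_neg (A : Matrix n n ℂ) : frameNorm F (-A) = frameNorm F A := by
  simp [frameNorm]

theorem frameNorm_sub_le (A B : Matrix n n ℂ) :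
    frameNorm F (A - B) ≤ frameNorm F A + frameNorm F B := by
  rw [sub_eq_add_neg, ← frameNorm_neg F B]
  exact frameNorm_add_le F _ _

theorem frameNorm_conjTranspose (A : Matrix n n ℂ) : frameNorm F Aᴴ = frameNorm F A := by
  refine Finset.sum_congr rfl fun i _ => ?_
  have : Fᴴ * Aᴴ * F = (Fᴴ * A * F)ᴴ := by
    simp [Matrix.conjTranspose_mul, Matrix.mul_assoc]
  rw [this, Matrix.conjTranspose_apply, norm_star]

theorem frameNorm_transpose (A : Matrix n n ℂ) :
    frameNorm F Aᵀ = frameNorm (F.map star) A := by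
  refine Finset.sum_congr rfl fun i _ => ?_
  have : Fᴴ * Aᵀ * F = ((F.map star)ᴴ * A * F.map star)ᵀ := by
    have h1 : (F.map star)ᴴ = Fᵀ := by ext; simp
    rw [h1, Matrix.transpose_mul, Matrix.transpose_mul, Matrix.transpose_transpose,
      Matrix.mul_assoc]
    rfl
  rw [this, Matrix.transpose_apply]

theorem norm_trace_le_frameNorm [DecidableEq n] (A : Matrix n n ℂ) :
    ‖A.trace‖ ≤ frameNorm (1 : Matrix n n ℂ) A := by
  simpa [frameNorm, Matrix.trace] using norm_sum_le Finset.univ fun i => A i i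

theorem norm_mul_frame [DecidableEq n] {F : Matrix n ι ℂ} (hF : F * Fᴴ = 1) {m : Type*} [Fintype m]
    (X : Matrix m n ℂ) : ‖X * F‖ = ‖X‖ := by
  have h : ((X * F)ᴴ * (X * F)).trace = (Xᴴ * X).trace := by
    rw [Matrix.conjTranspose_mul, Matrix.mul_assoc, Matrix.trace_mul_comm, Matrix.mul_assoc,
      Matrix.mul_assoc, hF, Matrix.mul_one]
  rw [trace_conjTranspose_mul_self, trace_conjTranspose_mul_self, Complex.ofReal_inj] at h
  exact (pow_left_inj₀ (norm_nonneg _) (norm_nonneg _) two_ne_zero).1 h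

/-- Hölder's inequality for a product of two Hilbert-Schmidt operators. -/
theorem frameNorm_conjTranspose_mul_le [DecidableEq n] {F : Matrix n ι ℂ} (hF : F * Fᴴ = 1)
    {m : Type*} [Fintype m] (X Y : Matrix m n ℂ) : frameNorm F (Xᴴ * Y) ≤ ‖X‖ * ‖Y‖ := by
  rw [← norm_mul_frame hF X, ← norm_mul_frame hF Y]
  set X' := X * F
  set Y' := Y * F
  have h1 : frameNorm F (Xᴴ * Y) ≤ ∑ p : ι × m, ‖X' p.2 p.1‖ * ‖Y' p.2 p.1‖ := by
    rw [Fintype.sum_prod_type]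
    refine Finset.sum_le_sum fun i _ => ?_
    have : Fᴴ * (Xᴴ * Y) * F = X'ᴴ * Y' := by
      simp [X', Y', Matrix.conjTranspose_mul, Matrix.mul_assoc]
    rw [this, Matrix.mul_apply]
    refine (norm_sum_le _ _).trans (Finset.sum_le_sum fun a _ => ?_)
    rw [norm_mul, Matrix.conjTranspose_apply, norm_star]
  refine h1.trans ?_
  refine (Real.sum_mul_le_sqrt_mul_sqrt _ _ _).trans_eq ?_
  congr 1
  · rw [Fintype.sum_prod_type_right, ← Real.sqrt_sq (norm_nonneg X'), frobenius_norm_sq]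
  · rw [Fintype.sum_prod_type_right, ← Real.sqrt_sq (norm_nonneg Y'), frobenius_norm_sq]

end frameNorm

theorem norm_trace_conjTranspose_mul_le {m n : Type*} [Fintype m] [Fintype n]
    (X Y : Matrix m n ℂ) : ‖(Xᴴ * Y).trace‖ ≤ ‖X‖ * ‖Y‖ := by
  classical
  exact (norm_trace_le_frameNorm _).trans (frameNorm_conjTranspose_mul_le (by simp) X Y)

/-! ### Rigidity of nearly optimal projections -/

theorem sum_norm_sq_dualOp_matrix_le {N : ℕ} [NeZero N] (hodd : Odd N) {m n : Type*} [Fintype m]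
    [Fintype n] (u : ZMod N → Matrix m n ℂ) :
    ∑ i, ‖dualOp (Real.cos (Real.pi / N)) u i‖ ^ 2 ≤
      4 * (∑ i, ((u i)ᴴ * dualOp (Real.cos (Real.pi / N)) u i).trace).re := by
  set c := Real.cos (Real.pi / N)
  have happ (i : ZMod N) (a : m) (b : n) :
      dualOp c u i a b = dualOp c (fun j => u j a b) i := by
    simp [dualOp, Matrix.sum_apply]
  have h (a : m) (b : n) := sum_norm_sq_dualOp_le hodd fun i => u i a b
  have h1 : ∑ i, ‖dualOp c u i‖ ^ 2 = ∑ a, ∑ b, ∑ i, ‖dualOp c (fun j => u j a b) i‖ ^ 2 := by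
    simp only [frobenius_norm_sq, happ]
    rw [Finset.sum_comm]
    exact Finset.sum_congr rfl fun a _ => Finset.sum_comm
  have h2 : (∑ i, ((u i)ᴴ * dualOp c u i).trace).re =
      ∑ a, ∑ b, (∑ i, star (u i a b) * dualOp c (fun j => u j a b) i).re := by
    simp only [← Complex.re_sum]
    congr 1
    simp only [Matrix.trace, Matrix.diag, Matrix.mul_apply, Matrix.conjTranspose_apply, happ]
    rw [Finset.sum_comm, Finset.sum_comm (s := (Finset.univ : Finset m))]
    exact Finset.sum_congr rfl fun b _ => Finset.sum_comm
  rw [h1, h2]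
  simp only [Finset.mul_sum]
  exact Finset.sum_le_sum fun a _ => Finset.sum_le_sum fun b _ => h a b

/-- The `Q i` are orthogonal projections, and those at cyclic neighbours are orthogonal to each
other. -/
structure IsCycleProj {N : ℕ} {m : Type*} [Fintype m] (Q : ZMod N → Matrix m m ℂ) : Prop where
  isHermitian : ∀ i, (Q i)ᴴ = Q i
  idempotent : ∀ i, Q i * Q i = Q i
  orthogonal : ∀ i, Q i * Q (i + 1) = 0

theorem IsCycleProj.orthogonal' {N : ℕ} {m : Type*} [Fintype m] {Q : ZMod N → Matrix m m ℂ}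
    (hQ : IsCycleProj Q) (i : ZMod N) : Q (i + 1) * Q i = 0 := by
  have := congrArg Matrix.conjTranspose (hQ.orthogonal i)
  simpa [Matrix.conjTranspose_mul, hQ.isHermitian] using this

theorem IsCycleProj.gram {N : ℕ} {m n : Type*} [Fintype m] {Q : ZMod N → Matrix m m ℂ}
    (hQ : IsCycleProj Q) (Ψ : Matrix m n ℂ) (i j : ZMod N) :
    (Q i * Ψ)ᴴ * (Q j * Ψ) = Ψᴴ * (Q i * Q j) * Ψ := by
  rw [Matrix.conjTranspose_mul, hQ.isHermitian]; simp only [Matrix.mul_assoc]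

theorem IsCycleProj.gram_self {N : ℕ} {m n : Type*} [Fintype m] {Q : ZMod N → Matrix m m ℂ}
    (hQ : IsCycleProj Q) (Ψ : Matrix m n ℂ) (i : ZMod N) :
    (Q i * Ψ)ᴴ * (Q i * Ψ) = Ψᴴ * (Q i * Ψ) := by
  rw [hQ.gram, hQ.idempotent, Matrix.mul_assoc]

theorem IsCycleProj.gram_state {N : ℕ} {m n : Type*} [Fintype m] {Q : ZMod N → Matrix m m ℂ}
    (hQ : IsCycleProj Q) (Ψ : Matrix m n ℂ) (i : ZMod N) : (Q i * Ψ)ᴴ * Ψ = Ψᴴ * (Q i * Ψ) := by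
  rw [Matrix.conjTranspose_mul, hQ.isHermitian, Matrix.mul_assoc]

section

variable {N : ℕ} [NeZero N] {m n : Type*} [Fintype m] [Fintype n] {Q : ZMod N → Matrix m m ℂ}

/-- The value `∑ i, tr (Q i ρ)` for `ρ = Ψ * Ψᴴ`. -/
noncomputable def cycleValue (Q : ZMod N → Matrix m m ℂ) (Ψ : Matrix m n ℂ) : ℝ :=
  (Ψᴴ * ∑ i, Q i * Ψ).trace.re

/-- The form `dualOp` evaluated on the vectors `Q i * Ψ`: the terms of neighbours vanish by
orthogonality. -/
theorem IsCycleProj.dual_identity (hQ : IsCycleProj Q) (Ψ : Matrix m n ℂ) :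
    (∑ i, ((Q i * Ψ)ᴴ * dualOp (Real.cos (Real.pi / N)) (fun j => Q j * Ψ) i).trace).re =
      2 * Real.cos (Real.pi / N) * cycleValue Q Ψ -
        (2 + 2 * Real.cos (Real.pi / N)) / N * ‖∑ i, Q i * Ψ‖ ^ 2 := by
  set c := Real.cos (Real.pi / N)
  set V := ∑ i, Q i * Ψ with hV
  have hterm (i : ZMod N) : (Q i * Ψ)ᴴ * dualOp c (fun j => Q j * Ψ) i =
      (2 * c) • (Ψᴴ * (Q i * Ψ)) - ((2 + 2 * c) / N) • ((Q i * Ψ)ᴴ * V) := by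
    have h1 : (Q i * Ψ)ᴴ * (Q (i + 1) * Ψ) = 0 := by
      rw [hQ.gram, hQ.orthogonal]; simp
    have h2 : (Q i * Ψ)ᴴ * (Q (i - 1) * Ψ) = 0 := by
      have := hQ.orthogonal' (i - 1)
      rw [sub_add_cancel] at this
      rw [hQ.gram, this]; simp
    rw [dualOp, Matrix.mul_sub, Matrix.mul_add, Matrix.mul_add, h1, h2, Matrix.mul_smul,
      Matrix.mul_smul, hQ.gram_self]
    simp [V]
  simp only [hterm]
  rw [← Matrix.trace_sum, Finset.sum_sub_distrib, ← Finset.smul_sum, ← Finset.smul_sum,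
    ← Matrix.mul_sum, ← hV, ← Matrix.sum_mul, ← Matrix.conjTranspose_sum, ← hV, Matrix.trace_sub,
    Matrix.trace_smul, Matrix.trace_smul, trace_conjTranspose_mul_self]
  simp only [Complex.sub_re, Complex.smul_re, smul_eq_mul, Complex.ofReal_re]
  rfl

theorem IsCycleProj.sum_norm_sq_dualOp_le (hQ : IsCycleProj Q) (Ψ : Matrix m n ℂ)
    (hodd : Odd N) (hN : 2 ≤ N) :
    ∑ i, ‖dualOp (Real.cos (Real.pi / N)) (fun j => Q j * Ψ) i‖ ^ 2 ≤
      8 * (1 + Real.cos (Real.pi / N)) / N *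
        (N * cosSq N * cycleValue Q Ψ - ‖∑ i, Q i * Ψ‖ ^ 2) := by
  refine (sum_norm_sq_dualOp_matrix_le hodd _).trans_eq ?_
  rw [hQ.dual_identity]
  have h := cosSq_mul N hN
  set c := Real.cos (Real.pi / N)
  have hN0 : (N : ℝ) ≠ 0 := NeZero.ne _
  have : 8 * (1 + c) / N * (N * cosSq N * cycleValue Q Ψ - ‖∑ i, Q i * Ψ‖ ^ 2) =
    8 * (cosSq N * (1 + c)) * cycleValue Q Ψ - 8 * (1 + c) / N * ‖∑ i, Q i * Ψ‖ ^ 2 := by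
      field_simp
  rw [this, h]
  ring

theorem IsCycleProj.norm_sum_sq_le (hQ : IsCycleProj Q) (Ψ : Matrix m n ℂ)
    (hodd : Odd N) (hN : 2 ≤ N) :
    ‖∑ i, Q i * Ψ‖ ^ 2 ≤ N * cosSq N * cycleValue Q Ψ := by
  have h := hQ.sum_norm_sq_dualOp_le Ψ hodd hN
  have h0 : 0 ≤ ∑ i, ‖dualOp (Real.cos (Real.pi / N)) (fun j => Q j * Ψ) i‖ ^ 2 :=
    Finset.sum_nonneg fun _ _ => by positivity
  have hN0 : (0 : ℝ) < N := by exact_mod_cast NeZero.pos N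
  have hc : 0 < 1 + Real.cos (Real.pi / N) := by linarith [cos_pi_div_nonneg hN]
  have := nonneg_of_mul_nonneg_right (h0.trans h) (by positivity)
  linarith

theorem cycleValue_le_norm {Ψ : Matrix m n ℂ} (hΨ : ‖Ψ‖ = 1) :
    cycleValue Q Ψ ≤ ‖∑ i, Q i * Ψ‖ := by
  have := norm_trace_conjTranspose_mul_le Ψ (∑ i, Q i * Ψ)
  rw [hΨ, one_mul] at this
  exact (Complex.re_le_norm _).trans this

theorem IsCycleProj.cycleValue_le (hQ : IsCycleProj Q) (hodd : Odd N) (hN : 5 ≤ N)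
    {Ψ : Matrix m n ℂ} (hΨ : ‖Ψ‖ = 1) :
    cycleValue Q Ψ ≤ N * cosSq N := by
  have h1 := hQ.norm_sum_sq_le Ψ hodd (by omega)
  have h2 := cycleValue_le_norm (Q := Q) hΨ
  have h3 := (cosSq_pos_and_lt_one hN).1
  rcases le_or_gt (cycleValue Q Ψ) 0 with h | h
  · exact h.trans (by positivity)
  · refine le_of_mul_le_mul_right ?_ h
    nlinarith

/-- Near optimality, the vectors `Q i * Ψ` satisfy an inhomogeneous linear recurrence up to `√ε`. -/
theorem IsCycleProj.norm_recurrence_le (hQ : IsCycleProj Q) (hodd : Odd N) (hN : 5 ≤ N)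
    {Ψ : Matrix m n ℂ} (hΨ : ‖Ψ‖ = 1) {ε : ℝ} (hε : 0 ≤ ε)
    (hβ : N * cosSq N - ε ≤ cycleValue Q Ψ) (i : ZMod N) :
    ‖Q (i + 1) * Ψ + Q (i - 1) * Ψ + (2 * Real.cos (Real.pi / N)) • (Q i * Ψ) -
      (2 * Real.cos (Real.pi / N)) • Ψ‖ ≤ 5 * √ε := by
  have hr := hQ.sum_norm_sq_dualOp_le Ψ hodd (by omega)
  have h1 := hQ.norm_sum_sq_le Ψ hodd (by omega)
  have h2 := cycleValue_le_norm (Q := Q) hΨ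
  have h3 := hQ.cycleValue_le hodd hN hΨ
  have hcs := cosSq_mul N (by omega)
  obtain ⟨hκ0, hκ1⟩ := cosSq_pos_and_lt_one hN
  have hc1 := half_lt_cos_pi_div hN
  have hc2 := Real.cos_le_one (Real.pi / N)
  have hN5 : (5 : ℝ) ≤ N := by exact_mod_cast hN
  set c := Real.cos (Real.pi / N)
  set κ := cosSq N
  set β := cycleValue Q Ψ
  set V := ∑ i, Q i * Ψ
  set r := dualOp c (fun j => Q j * Ψ) with hrd
  have hN0 : (N : ℝ) ≠ 0 := by linarith
  -- the residual of the sum of squares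
  have hri : ‖r i‖ ≤ 3 * √ε := by
    have hle : ‖r i‖ ^ 2 ≤ 8 * (1 + c) / N * (N * κ * β - ‖V‖ ^ 2) :=
      (Finset.single_le_sum (f := fun i => ‖r i‖ ^ 2) (fun _ _ => by positivity)
        (Finset.mem_univ i)).trans hr
    have hβ2 : N * κ * β - ‖V‖ ^ 2 ≤ N * κ * ε := by
      have : 0 ≤ N * κ := by positivity
      rcases le_or_gt 0 β with hb | hb
      · nlinarith [mul_le_mul h2 h2 hb (norm_nonneg V)]
      · nlinarith [sq_nonneg ‖V‖]
    have : ‖r i‖ ^ 2 ≤ 8 * c * ε := by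
      refine hle.trans ((mul_le_mul_of_nonneg_left hβ2 (by positivity)).trans_eq ?_)
      rw [show 8 * (1 + c) / N * (N * κ * ε) = 8 * (κ * (1 + c)) * ε by field_simp, hcs]
    refine le_of_sq_le_sq ?_ (by positivity)
    rw [mul_pow, Real.sq_sqrt hε]
    nlinarith
  -- the mean of the vectors is close to a multiple of the state
  have hVΨ : ‖V - (N * κ) • Ψ‖ ≤ √(N * ε) := by
    have hexp : ‖V - (N * κ) • Ψ‖ ^ 2 = ‖V‖ ^ 2 - 2 * (N * κ) * β + (N * κ) ^ 2 := by
      have hcast (X : Matrix m n ℂ) : ‖X‖ ^ 2 = (Xᴴ * X).trace.re := by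
        rw [trace_conjTranspose_mul_self, Complex.ofReal_re]
      have hsym : (Vᴴ * Ψ).trace.re = β := by
        have : Vᴴ * Ψ = (Ψᴴ * V)ᴴ := by simp [Matrix.conjTranspose_mul]
        rw [this, Matrix.trace_conjTranspose]
        exact Complex.conj_re _
      have hΨ2 : (Ψᴴ * Ψ).trace.re = 1 := by rw [← hcast, hΨ, one_pow]
      have hβ' : (Ψᴴ * V).trace.re = β := rfl
      rw [hcast, hcast]
      simp only [Matrix.conjTranspose_sub, Matrix.conjTranspose_smul, Matrix.sub_mul,
        Matrix.mul_sub, Matrix.smul_mul, Matrix.mul_smul, Matrix.trace_sub, Matrix.trace_smul,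
        Complex.sub_re, Complex.smul_re, smul_eq_mul, star_trivial, hsym, hΨ2, hβ']
      ring
    refine le_of_sq_le_sq ?_ (by positivity)
    rw [hexp, Real.sq_sqrt (by positivity)]
    have : 0 ≤ N * κ := by positivity
    have hle : N * κ * ε ≤ N * ε := by nlinarith [mul_nonneg (by positivity : (0:ℝ) ≤ N) hε]
    nlinarith
  have hdecomp : Q (i + 1) * Ψ + Q (i - 1) * Ψ + (2 * c) • (Q i * Ψ) - (2 * c) • Ψ =
      r i + ((2 + 2 * c) / N) • (V - (N * κ) • Ψ) := by
    have : (2 * c) = (2 + 2 * c) / N * (N * κ) := by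
      field_simp; linarith
    rw [smul_sub, smul_smul, ← this, hrd, dualOp]
    abel
  rw [hdecomp]
  refine (norm_add_le _ _).trans ?_
  have hs : (2 + 2 * c) / N * √(N * ε) ≤ 2 * √ε := by
    rw [Real.sqrt_mul (by positivity), ← mul_assoc]
    refine mul_le_mul_of_nonneg_right ?_ (Real.sqrt_nonneg _)
    rw [div_mul_eq_mul_div, div_le_iff₀ (by positivity)]
    have hs2 : 2 ≤ √(N : ℝ) := Real.le_sqrt_of_sq_le (by linarith)
    nlinarith [Real.sq_sqrt (by positivity : (0 : ℝ) ≤ N)]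
  rw [norm_smul, Real.norm_of_nonneg (by positivity)]
  have := mul_le_mul_of_nonneg_left hVΨ (by positivity : 0 ≤ (2 + 2 * c) / N)
  linarith

theorem norm_mul_le_one {P : Matrix m m ℂ} (hP : Pᴴ = P) (hP' : P * P = P) {Ψ : Matrix m n ℂ}
    (hΨ : ‖Ψ‖ = 1) : ‖P * Ψ‖ ≤ 1 := by
  have h : ((P * Ψ)ᴴ * (P * Ψ)) = Ψᴴ * (P * Ψ) := by
    rw [Matrix.conjTranspose_mul, hP, Matrix.mul_assoc, ← Matrix.mul_assoc P, hP']
  have h1 := norm_trace_conjTranspose_mul_le Ψ (P * Ψ)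
  rw [← h, trace_conjTranspose_mul_self, hΨ, one_mul, Complex.norm_real, Real.norm_of_nonneg
    (by positivity)] at h1
  nlinarith [norm_nonneg (P * Ψ)]

/-- Steps of length two reach all of `ℤ / N` for odd `N`, so a quantity obeying the triangle
inequality that is small on such steps is small throughout. -/
theorem le_natCast_mul_of_step_two (hodd : Odd N) {D : ZMod N → ZMod N → ℝ} {δ : ℝ} (hδ : 0 ≤ δ)
    (hrefl : ∀ i, D i i ≤ 0) (htri : ∀ i j k, D i k ≤ D i j + D j k)
    (hstep : ∀ i, D i (i + 2) ≤ δ) (i j : ZMod N) : D i j ≤ N * δ := by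
  have hchain (k : ℕ) : D i (i + 2 * k) ≤ k * δ := by
    induction k with
    | zero => simpa using hrefl i
    | succ k ih =>
      have h := htri i (i + 2 * k) (i + 2 * k + 2)
      have h' := hstep (i + 2 * k)
      have e : i + 2 * ((k + 1 : ℕ) : ZMod N) = i + 2 * k + 2 := by push_cast; ring
      rw [e]
      push_cast
      linarith
  obtain ⟨t, ht⟩ := hodd
  -- `t + 1` is the inverse of `2` modulo `N`
  have htwo : (2 : ZMod N) * (t + 1) = 1 := by
    have : ((2 * t + 1 : ℕ) : ZMod N) = 0 := by rw [← ht, ZMod.natCast_self]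
    push_cast at this
    linear_combination this
  set x : ZMod N := (t + 1) * (j - i)
  have hx : j = i + 2 * (x.val : ℕ) := by
    rw [ZMod.natCast_zmod_val]
    linear_combination -(j - i) * htwo
  have h := hchain x.val
  rw [← hx] at h
  refine h.trans (mul_le_mul_of_nonneg_right ?_ hδ)
  exact_mod_cast (ZMod.val_lt x).le

/-- The recurrence around `i + 1`, multiplied by `(Q i * Ψ)ᴴ` and by `(Q (i + 2) * Ψ)ᴴ`, expresses
the cross term `(Q i * Ψ)ᴴ * (Q (i + 2) * Ψ)` and its adjoint in terms of the two operators
compared here. -/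
theorem IsCycleProj.frameNorm_step_le (hQ : IsCycleProj Q) (hodd : Odd N) (hN : 5 ≤ N)
    {Ψ : Matrix m n ℂ} (hΨ : ‖Ψ‖ = 1) {ε : ℝ} (hε : 0 ≤ ε) (hβ : N * cosSq N - ε ≤ cycleValue Q Ψ)
    [DecidableEq n] {ι : Type*} [Fintype ι] {F : Matrix n ι ℂ} (hF : F * Fᴴ = 1) (i : ZMod N) :
    frameNorm F (Ψᴴ * (Q i * Ψ) - Ψᴴ * (Q (i + 2) * Ψ)) ≤
      10 / (2 * Real.cos (Real.pi / N) - 1) * √ε := by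
  have he := hQ.norm_recurrence_le hodd hN hΨ hε hβ (i + 1)
  have hc := half_lt_cos_pi_div hN
  set c := Real.cos (Real.pi / N)
  set e := Q (i + 1 + 1) * Ψ + Q (i + 1 - 1) * Ψ + (2 * c) • (Q (i + 1) * Ψ) - (2 * c) • Ψ with hed
  have e1 : i + 1 + 1 = i + 2 := by ring
  have e2 : i + 1 - 1 = i := by ring
  rw [e1, e2] at hed
  have hadj1 : Q i * Q (i + 1) = 0 := hQ.orthogonal i
  have hadj2 : Q (i + 2) * Q (i + 1) = 0 := by rw [← e1]; exact hQ.orthogonal' _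
  -- the terms with neighbouring projections drop out of both products
  have hA : (Q i * Ψ)ᴴ * e = Ψᴴ * (Q i * Q (i + 2)) * Ψ - (2 * c - 1) • (Ψᴴ * (Q i * Ψ)) := by
    rw [hed, Matrix.mul_sub, Matrix.mul_add, Matrix.mul_add, Matrix.mul_smul, Matrix.mul_smul,
      hQ.gram_self, hQ.gram_state, hQ.gram, hQ.gram, hadj1]
    simp only [Matrix.mul_zero, Matrix.zero_mul, smul_zero, add_zero]
    module
  have hB : (Q (i + 2) * Ψ)ᴴ * e =
      Ψᴴ * (Q (i + 2) * Q i) * Ψ - (2 * c - 1) • (Ψᴴ * (Q (i + 2) * Ψ)) := by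
    rw [hed, Matrix.mul_sub, Matrix.mul_add, Matrix.mul_add, Matrix.mul_smul, Matrix.mul_smul,
      hQ.gram_self, hQ.gram_state, hQ.gram, hQ.gram, hadj2]
    simp only [Matrix.mul_zero, Matrix.zero_mul, smul_zero, add_zero]
    module
  have hBstar : ((Q (i + 2) * Ψ)ᴴ * e)ᴴ =
      Ψᴴ * (Q i * Q (i + 2)) * Ψ - (2 * c - 1) • (Ψᴴ * (Q (i + 2) * Ψ)) := by
    rw [hB]
    simp [Matrix.conjTranspose_mul, hQ.isHermitian, Matrix.mul_assoc]
  have hdiff : Ψᴴ * (Q i * Ψ) - Ψᴴ * (Q (i + 2) * Ψ) =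
      (2 * c - 1)⁻¹ • (((Q (i + 2) * Ψ)ᴴ * e)ᴴ - (Q i * Ψ)ᴴ * e) := by
    rw [hA, hBstar, sub_sub_sub_cancel_left, ← smul_sub, smul_smul, inv_mul_cancel₀ (by linarith),
      one_smul]
  have hbound (j : ZMod N) : frameNorm F ((Q j * Ψ)ᴴ * e) ≤ 5 * √ε := by
    refine (frameNorm_conjTranspose_mul_le hF _ _).trans ?_
    have := norm_mul_le_one (hQ.isHermitian j) (hQ.idempotent j) hΨ
    nlinarith [norm_nonneg e, norm_nonneg (Q j * Ψ)]
  have h2c : 0 < 2 * c - 1 := by linarith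
  rw [hdiff, frameNorm_smul, abs_of_pos (by positivity), div_eq_inv_mul, mul_assoc]
  refine mul_le_mul_of_nonneg_left ?_ (by positivity)
  refine (frameNorm_sub_le F _ _).trans ?_
  rw [frameNorm_conjTranspose]
  linarith [hbound i, hbound (i + 2)]

theorem IsCycleProj.frameNorm_sub_cosSq_smul_le (hQ : IsCycleProj Q) (hodd : Odd N) (hN : 5 ≤ N)
    {Ψ : Matrix m n ℂ} (hΨ : ‖Ψ‖ = 1) {ε : ℝ} (hε : 0 ≤ ε) (hβ : N * cosSq N - ε ≤ cycleValue Q Ψ)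
    [DecidableEq n] {ι : Type*} [Fintype ι] {F : Matrix n ι ℂ} (hF : F * Fᴴ = 1) (i : ZMod N) :
    frameNorm F (Ψᴴ * (Q i * Ψ) - cosSq N • (Ψᴴ * Ψ)) ≤
      (20 * N / (2 * Real.cos (Real.pi / N) - 1) + 5) * √ε := by
  have he := hQ.norm_recurrence_le hodd hN hΨ hε hβ i
  have hc := half_lt_cos_pi_div hN
  have hcs := cosSq_mul N (by omega)
  have hstep := hQ.frameNorm_step_le hodd hN hΨ hε hβ hF
  set c := Real.cos (Real.pi / N)
  have h2c : 0 < 2 * c - 1 := by linarith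
  set D : ZMod N → Matrix n n ℂ := fun j => Ψᴴ * (Q j * Ψ)
  have hdist (j k : ZMod N) : frameNorm F (D j - D k) ≤ N * (10 / (2 * c - 1) * √ε) := by
    refine le_natCast_mul_of_step_two hodd (D := fun j k => frameNorm F (D j - D k)) (by positivity)
      (fun i => ?_) (fun i j k => ?_) hstep j k
    · simp [frameNorm]
    · have := frameNorm_add_le F (D i - D j) (D j - D k)
      rwa [sub_add_sub_cancel] at this
  set e := Q (i + 1) * Ψ + Q (i - 1) * Ψ + (2 * c) • (Q i * Ψ) - (2 * c) • Ψ with hed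
  have hΨe : frameNorm F (Ψᴴ * e) ≤ 5 * √ε := by
    refine (frameNorm_conjTranspose_mul_le hF _ _).trans ?_
    rwa [hΨ, one_mul]
  have hmul : Ψᴴ * e = D (i + 1) + D (i - 1) + (2 * c) • D i - (2 * c) • (Ψᴴ * Ψ) := by
    simp only [hed, D, Matrix.mul_sub, Matrix.mul_add, Matrix.mul_smul]
  have hkey : D i - cosSq N • (Ψᴴ * Ψ) =
      (2 + 2 * c)⁻¹ • ((D i - D (i + 1)) + (D i - D (i - 1)) + Ψᴴ * e) := by
    have hne : 2 + 2 * c ≠ 0 := by linarith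
    have hκ : cosSq N = (2 + 2 * c)⁻¹ * (2 * c) := by
      field_simp; linarith
    rw [hmul, hκ, mul_smul, eq_inv_smul_iff₀ hne, smul_sub, smul_inv_smul₀ hne]
    module
  have hsum : frameNorm F ((D i - D (i + 1)) + (D i - D (i - 1)) + Ψᴴ * e) ≤
      (20 * N / (2 * c - 1) + 5) * √ε := by
    refine (frameNorm_add_le F _ _).trans ?_
    have h := frameNorm_add_le F (D i - D (i + 1)) (D i - D (i - 1))
    have h1 := hdist i (i + 1)
    have h2 := hdist i (i - 1)
    have : (20 * N / (2 * c - 1) + 5) * √ε =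
      N * (10 / (2 * c - 1) * √ε) + N * (10 / (2 * c - 1) * √ε) + 5 * √ε := by ring
    linarith
  change frameNorm F (D i - _) ≤ _
  rw [hkey, frameNorm_smul, abs_of_pos (by positivity)]
  have hinv : (2 + 2 * c)⁻¹ ≤ 1 := inv_le_one_of_one_le₀ (by linarith)
  exact (mul_le_of_le_one_left (frameNorm_nonneg F _) hinv).trans hsum

end

end Frobenius

/-! ### The trace norm of classical-quantum operators -/

open scoped MatrixOrder ComplexOrder Matrix.Norms.L2Operator in
/-- The eigenbasis of a Hermitian matrix computes its trace norm. -/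
theorem traceNorm_eq_frameNorm {n : Type*} [Fintype n] [DecidableEq n] {A : Matrix n n ℂ}
    (hA : A.IsHermitian) : ∃ U : Matrix n n ℂ, U * Uᴴ = 1 ∧ traceNorm A = frameNorm U A := by
  set U : Matrix n n ℂ := (hA.eigenvectorUnitary : Matrix n n ℂ)
  have hU : U * Uᴴ = 1 := Unitary.mul_star_self_of_mem hA.eigenvectorUnitary.2
  have hU' : Uᴴ * U = 1 := Unitary.star_mul_self_of_mem hA.eigenvectorUnitary.2
  have hspec : A = U * Matrix.diagonal (fun i => (hA.eigenvalues i : ℂ)) * Uᴴ := by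
    conv_lhs => rw [hA.spectral_theorem, Unitary.conjStarAlgAut_apply]
    rfl
  have hcancel (X Y : Matrix n n ℂ) : (U * X * Uᴴ) * (U * Y * Uᴴ) = U * (X * Y) * Uᴴ := by
    simp only [Matrix.mul_assoc]
    rw [← Matrix.mul_assoc Uᴴ U, hU', Matrix.one_mul]
  refine ⟨U, hU, ?_⟩
  have hsqrt : CFC.sqrt (Aᴴ * A) =
      U * Matrix.diagonal (fun i => ((|hA.eigenvalues i| : ℝ) : ℂ)) * Uᴴ := by
    refine CFC.sqrt_unique ?_ (Matrix.PosSemidef.nonneg ?_)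
    · rw [hA.eq, hcancel]
      conv_rhs => rw [hspec, hcancel]
      simp only [Matrix.diagonal_mul_diagonal, ← Complex.ofReal_mul, abs_mul_abs_self]
    · refine Matrix.PosSemidef.mul_mul_conjTranspose_same (Matrix.PosSemidef.diagonal fun i => ?_) U
      simp
  have hdiag : Uᴴ * A * U = Matrix.diagonal (fun i => (hA.eigenvalues i : ℂ)) := by
    conv_lhs => rw [hspec]
    simp only [Matrix.mul_assoc, hU', Matrix.mul_one]
    rw [← Matrix.mul_assoc, hU', Matrix.one_mul]
  rw [traceNorm, hsqrt, Matrix.trace_mul_comm, ← Matrix.mul_assoc, hU', Matrix.one_mul, frameNorm,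
    hdiag]
  simp [Matrix.trace]

/-- Contracting a Parseval frame of the tensor product with the unit vector `k` gives a Parseval
frame of the second factor. -/
theorem exists_frame_ketbra_kronecker {m n ι : Type*} [Fintype m] [Fintype n] [Fintype ι]
    [DecidableEq m] [DecidableEq n] {U : Matrix (m × n) ι ℂ} (hU : U * Uᴴ = 1) {k : m → ℂ}
    (hk : star k ⬝ᵥ k = 1) :
    ∃ F : Matrix n ι ℂ, F * Fᴴ = 1 ∧
      ∀ A : Matrix n n ℂ, frameNorm U (ketbra k ⊗ₖ A) = frameNorm F A := by
  set K : Matrix (m × n) n ℂ := Matrix.of fun p x => k p.1 * (1 : Matrix n n ℂ) p.2 x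
  have hK : Kᴴ * K = 1 := by
    ext x y
    have : ∑ a, star (k a) * k a = 1 := hk
    simp only [K, Matrix.mul_apply, Matrix.conjTranspose_apply, Matrix.of_apply,
      Fintype.sum_prod_type, Matrix.one_apply, star_mul']
    have hterm (a : m) : ∑ z, star (k a) * star (if z = x then (1 : ℂ) else 0) *
        (k a * if z = y then 1 else 0) = star (k a) * k a * if x = y then 1 else 0 := by
      simp [apply_ite star, eq_comm]
    rw [Finset.sum_congr rfl fun a _ => hterm a, ← Finset.sum_mul, this, one_mul]
  have hKA (A : Matrix n n ℂ) : ketbra k ⊗ₖ A = K * A * Kᴴ := by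
    ext ⟨a, x⟩ ⟨b, y⟩
    simp only [K, ketbra, Matrix.mul_apply, Matrix.kroneckerMap_apply, Matrix.vecMulVec_apply,
      Matrix.conjTranspose_apply, Matrix.of_apply, Matrix.one_apply, Pi.star_apply]
    simp [apply_ite star]
    ring
  refine ⟨Kᴴ * U, ?_, fun A => ?_⟩
  · rw [Matrix.conjTranspose_mul, Matrix.conjTranspose_conjTranspose, Matrix.mul_assoc,
      ← Matrix.mul_assoc U, hU, Matrix.one_mul, hK]
  · simp only [frameNorm, hKA, Matrix.conjTranspose_mul, Matrix.conjTranspose_conjTranspose,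
      Matrix.mul_assoc]

theorem ketbra_isHermitian {n : Type*} (v : n → ℂ) : (ketbra v).IsHermitian := by
  ext i j
  simp [ketbra, Matrix.vecMulVec_apply, mul_comm]

/-- The trace norm of a classical-quantum operator is bounded by bounds for its blocks. -/
theorem traceNorm_sum_ketbra_kronecker_le {m n α : Type*} [Fintype m] [Fintype n] [DecidableEq m]
    [DecidableEq n] [Fintype α] {k : α → m → ℂ} (hk : ∀ a, star (k a) ⬝ᵥ k a = 1)
    {B : α → Matrix n n ℂ} (hB : ∀ a, (B a).IsHermitian) {b : α → ℝ}
    (hb : ∀ a, ∀ F : Matrix n (m × n) ℂ, F * Fᴴ = 1 → frameNorm F (B a) ≤ b a) :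
    traceNorm (∑ a, ketbra (k a) ⊗ₖ (B a)ᵀ) ≤ ∑ a, b a := by
  have hH : (∑ a, ketbra (k a) ⊗ₖ (B a)ᵀ).IsHermitian := by
    rw [Matrix.IsHermitian, Matrix.conjTranspose_sum]
    refine Finset.sum_congr rfl fun a _ => ?_
    rw [Matrix.conjTranspose_kronecker, (ketbra_isHermitian _).eq, (hB a).transpose.eq]
  obtain ⟨U, hU, hT⟩ := traceNorm_eq_frameNorm hH
  have hsum (s : Finset α) : frameNorm U (∑ a ∈ s, ketbra (k a) ⊗ₖ (B a)ᵀ) ≤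
      ∑ a ∈ s, frameNorm U (ketbra (k a) ⊗ₖ (B a)ᵀ) :=
    Finset.le_sum_of_subadditive (frameNorm U) (by simp [frameNorm]) (frameNorm_add_le U) s _
  rw [hT]
  refine (hsum _).trans (Finset.sum_le_sum fun a _ => ?_)
  obtain ⟨F, hF, hFA⟩ := exists_frame_ketbra_kronecker hU (hk a)
  rw [hFA, frameNorm_transpose]
  exact hb a _ (map_star_mul_conjTranspose hF)

/-! ### Strategies as cyclically orthogonal projections -/

theorem ketbra_mul_ketbra {n : Type*} [Fintype n] (v w : n → ℂ) :
    ketbra v * ketbra w = (star v ⬝ᵥ w) • Matrix.vecMulVec v (star w) := by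
  rw [ketbra, ketbra, Matrix.vecMulVec_mul_vecMulVec, Matrix.vecMulVec_smul]

/-- A rank-one projection that commutes with a projection `P` lies either below `P` or below
`1 - P`. -/
theorem mul_one_sub_eq_zero_or {n : Type*} [Fintype n] [DecidableEq n] {v : n → ℂ}
    (hv : star v ⬝ᵥ v = 1) {P : Matrix n n ℂ} (hP : P * P = P) (hc : Commute (ketbra v) P) :
    ketbra v * (1 - P) = 0 ∨ ketbra v * (1 - P) = ketbra v := by
  set a := star v ⬝ᵥ (P *ᵥ v)
  have hvv : ketbra v * ketbra v = ketbra v := by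
    rw [ketbra_mul_ketbra, hv, one_smul]; rfl
  have h1 : ketbra v * P = a • ketbra v := by
    have : ketbra v * P * ketbra v = a • ketbra v := by
      rw [Matrix.mul_assoc]
      nth_rw 2 [ketbra]
      rw [Matrix.mul_vecMulVec, ketbra, Matrix.vecMulVec_mul_vecMulVec, Matrix.vecMulVec_smul]
    rw [← this, Matrix.mul_assoc, ← hc.eq, ← Matrix.mul_assoc, hvv]
  have h2 : a • (a • ketbra v) = a • ketbra v := by
    conv_rhs => rw [← h1, ← hP, ← Matrix.mul_assoc, h1, Matrix.smul_mul, h1]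
  have h3 : ketbra v ≠ 0 := fun h => by
    have := congrArg Matrix.trace h
    rw [ketbra, Matrix.trace_vecMulVec, dotProduct_comm, hv] at this
    simp at this
  rw [smul_smul, ← sub_eq_zero, ← sub_smul, smul_eq_zero, or_iff_left h3] at h2
  have h4 : a * (a - 1) = 0 := by linear_combination h2
  rw [Matrix.mul_sub, Matrix.mul_one, h1]
  rcases mul_eq_zero.1 h4 with h | h
  · right; rw [h, zero_smul, sub_zero]
  · left; rw [sub_eq_zero.1 h, one_smul, sub_self]

namespace Strategy

variable {N d : ℕ} {S : Strategy N d}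

/-- The projection `Π i (1 - Π (i + 1))` for the outcomes `1` of measurement `i` and `0` of its
cyclic successor. -/
noncomputable def edgeProj (S : Strategy N d) (i : Fin N) : Matrix (Fin d) (Fin d) ℂ :=
  S.P i * (1 - S.P (finRotate N i))

/-- The projections `edgeProj` with indices in `ℤ / N`. -/
noncomputable def cycleProj [NeZero N] (S : Strategy N d) (i : ZMod N) :
    Matrix (Fin d) (Fin d) ℂ :=
  S.edgeProj ((ZMod.finEquiv N).symm i)

theorem IsQuantum.edgeProj_isHermitian (hS : S.IsQuantum) (i : Fin N) :
    (S.edgeProj i)ᴴ = S.edgeProj i := by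
  have h := (hS.compatible i).eq
  rw [edgeProj, Matrix.conjTranspose_mul, Matrix.conjTranspose_sub, Matrix.conjTranspose_one,
    (hS.isHermitian _).eq, (hS.isHermitian _).eq, Matrix.sub_mul, Matrix.mul_sub, h]
  simp

theorem IsQuantum.edgeProj_mul (hS : S.IsQuantum) (i : Fin N) :
    S.edgeProj i * S.P i = S.edgeProj i := by
  rw [← hS.edgeProj_isHermitian i, edgeProj]
  simp only [Matrix.conjTranspose_mul, (hS.isHermitian i).eq, Matrix.mul_assoc, hS.idempotent]

theorem IsQuantum.isCycleProj [NeZero N] (hS : S.IsQuantum) : IsCycleProj S.cycleProj where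
  isHermitian i := hS.edgeProj_isHermitian _
  idempotent i := by
    have h2 (j : Fin N) : (1 - S.P j) * (1 - S.P j) = 1 - S.P j := by
      rw [Matrix.mul_sub, Matrix.mul_one, Matrix.sub_mul, hS.idempotent]; simp
    rw [cycleProj]
    generalize (ZMod.finEquiv N).symm i = j
    rw [edgeProj, ← Matrix.mul_assoc, ← edgeProj, hS.edgeProj_mul, edgeProj, Matrix.mul_assoc, h2]
  orthogonal i := by
    have h1 : (ZMod.finEquiv N).symm (i + 1) = finRotate N ((ZMod.finEquiv N).symm i) := by
      rw [finRotate_apply, map_add, map_one]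
    have h2 (j : Fin N) : (1 - S.P j) * S.P j = 0 := by
      rw [Matrix.sub_mul, hS.idempotent]; simp
    rw [cycleProj, cycleProj, h1, edgeProj, edgeProj, Matrix.mul_assoc,
      ← Matrix.mul_assoc (1 - _), h2]
    simp

theorem IsQuantum.beta_eq_cycleValue [NeZero N] (hS : S.IsQuantum) {m : Type*} [Fintype m]
    {Ψ : Matrix (Fin d) m ℂ} (hΨ : Ψ * Ψᴴ = S.ρ) : S.beta = cycleValue S.cycleProj Ψ := by
  have hterm (i : Fin N) :
      S.prob₂ 1 0 i (finRotate N i) = (Ψᴴ * (S.edgeProj i * Ψ)).trace.re := by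
    rw [Matrix.trace_mul_comm, Matrix.mul_assoc, hΨ, prob₂]
    simp only [M, if_true, zero_ne_one, if_false]
    rw [Matrix.trace_mul_comm, Matrix.mul_assoc (S.P i * S.ρ), ← edgeProj, Matrix.mul_assoc,
      Matrix.trace_mul_comm, Matrix.mul_assoc, hS.edgeProj_mul, Matrix.trace_mul_comm]
  rw [cycleValue, Matrix.mul_sum, Matrix.trace_sum, Complex.re_sum, beta]
  simp only [hterm]
  exact (Equiv.sum_comp (ZMod.finEquiv N).symm.toEquiv
    fun i => (Ψᴴ * (S.edgeProj i * Ψ)).trace.re).symm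

open scoped Matrix.Norms.Frobenius in
theorem norm_purification {d : ℕ} {ρ : Matrix (Fin d) (Fin d) ℂ} (hρ : ρ.trace = 1) {m : Type*}
    [Fintype m] {Ψ : Matrix (Fin d) m ℂ} (hΨ : Ψ * Ψᴴ = ρ) : ‖Ψ‖ = 1 := by
  have h := trace_conjTranspose_mul_self Ψ
  rw [Matrix.trace_mul_comm, hΨ, hρ] at h
  have h' : ‖Ψ‖ ^ 2 = 1 := by exact_mod_cast h.symm
  nlinarith [norm_nonneg Ψ]

open scoped MatrixOrder ComplexOrder Matrix.Norms.L2Operator in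
/-- The upper bound on the quantum value, for mixed states and projections of any rank. -/
theorem IsQuantum.beta_le (hodd : Odd N) (hN : 5 ≤ N) (hS : S.IsQuantum) :
    S.beta ≤ N * cosSq N := by
  have : NeZero N := ⟨by omega⟩
  obtain ⟨X, hX⟩ : ∃ X : Matrix (Fin d) (Fin d) ℂ, S.ρ = Xᴴ * X := by
    exact CStarAlgebra.nonneg_iff_eq_star_mul_self.1 hS.posSemidef.nonneg
  have hΨ : Xᴴ * Xᴴᴴ = S.ρ := by rw [Matrix.conjTranspose_conjTranspose, hX]
  rw [hS.beta_eq_cycleValue hΨ]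
  exact hS.isCycleProj.cycleValue_le hodd hN (norm_purification hS.trace_eq_one hΨ)

end Strategy

/-! ### The optimal strategy -/

theorem cos_angle_finRotate {N : ℕ} (hodd : Odd N) (i : Fin N) :
    Real.cos (angle N (finRotate N i) - angle N i) = -Real.cos (Real.pi / N) := by
  obtain ⟨t, ht⟩ := hodd
  obtain ⟨n, rfl⟩ : ∃ n, N = n + 1 := ⟨2 * t, ht⟩
  obtain rfl : n = 2 * t := by omega
  have hN0 : ((2 * t + 1 : ℕ) : ℝ) ≠ 0 := by positivity
  unfold angle
  rw [coe_finRotate]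
  split_ifs with h
  · have hi : ((i : ℕ) : ℝ) = 2 * t := by rw [h]; simp
    have : ((((0 : ℕ) : ℝ) + 1) * Real.pi * (((2 * t + 1 : ℕ) : ℝ) - 1) / ((2 * t + 1 : ℕ) : ℝ) -
        ((i : ℝ) + 1) * Real.pi * (((2 * t + 1 : ℕ) : ℝ) - 1) / ((2 * t + 1 : ℕ) : ℝ)) =
        -(Real.pi / ((2 * t + 1 : ℕ) : ℝ) - Real.pi) - t * (2 * Real.pi) := by
      rw [hi]; push_cast at hN0 ⊢; field_simp; ring
    rw [this, Real.cos_sub_nat_mul_two_pi, Real.cos_neg, Real.cos_sub_pi]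
  · have : ((((i : ℕ) + 1 : ℕ) : ℝ) + 1) * Real.pi * (((2 * t + 1 : ℕ) : ℝ) - 1) /
        ((2 * t + 1 : ℕ) : ℝ) -
        ((i : ℝ) + 1) * Real.pi * (((2 * t + 1 : ℕ) : ℝ) - 1) / ((2 * t + 1 : ℕ) : ℝ) =
        Real.pi - Real.pi / ((2 * t + 1 : ℕ) : ℝ) := by
      push_cast at hN0 ⊢; field_simp; ring
    rw [this, Real.cos_pi_sub]

theorem star_idealVec_dotProduct {N : ℕ} (hN : 5 ≤ N) (i j : Fin N) :
    star (idealVec N i) ⬝ᵥ idealVec N j =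
      ((cosSq N + (1 - cosSq N) * Real.cos (angle N j - angle N i) : ℝ) : ℂ) := by
  obtain ⟨h0, h1⟩ := cosSq_pos_and_lt_one hN
  have hs0 : √(cosSq N) * √(cosSq N) = cosSq N := Real.mul_self_sqrt h0.le
  have hs1 : √(1 - cosSq N) * √(1 - cosSq N) = 1 - cosSq N := Real.mul_self_sqrt (by linarith)
  simp only [idealVec, dotProduct, Fin.sum_univ_three, Pi.star_apply, Matrix.cons_val_zero,
    Matrix.cons_val_one, Matrix.cons_val, ← starRingEnd_apply, Complex.conj_ofReal,
    ← Complex.ofReal_mul, ← Complex.ofReal_add]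
  rw [Complex.ofReal_inj, Real.cos_sub]
  linear_combination hs0 + (Real.sin (angle N i) * Real.sin (angle N j) +
    Real.cos (angle N i) * Real.cos (angle N j)) * hs1

theorem star_idealVec_dotProduct_self {N : ℕ} (hN : 5 ≤ N) (i : Fin N) :
    star (idealVec N i) ⬝ᵥ idealVec N i = 1 := by
  rw [star_idealVec_dotProduct hN]; simp

theorem star_idealVec_dotProduct_finRotate {N : ℕ} (hN : 5 ≤ N) (hodd : Odd N) (i : Fin N) :
    star (idealVec N i) ⬝ᵥ idealVec N (finRotate N i) = 0 := by
  rw [star_idealVec_dotProduct hN, cos_angle_finRotate hodd, Complex.ofReal_eq_zero]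
  linear_combination cosSq_mul N (by omega)

theorem ideal_mul_finRotate {N : ℕ} (hN : 5 ≤ N) (hodd : Odd N) (i : Fin N) :
    (ideal N).P i * (ideal N).P (finRotate N i) = 0 := by
  simp only [ideal]
  rw [ketbra_mul_ketbra, star_idealVec_dotProduct_finRotate hN hodd, zero_smul]

theorem ideal_finRotate_mul {N : ℕ} (hN : 5 ≤ N) (hodd : Odd N) (i : Fin N) :
    (ideal N).P (finRotate N i) * (ideal N).P i = 0 := by
  have := congrArg Matrix.conjTranspose (ideal_mul_finRotate hN hodd i)
  rw [Matrix.conjTranspose_mul, Matrix.conjTranspose_zero] at this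
  simpa only [ideal, (ketbra_isHermitian _).eq] using this

open scoped ComplexOrder in
theorem ideal_isQuantum {N : ℕ} (hN : 5 ≤ N) (hodd : Odd N) : (ideal N).IsQuantum where
  posSemidef := Matrix.posSemidef_vecMulVec_self_star _
  trace_eq_one := by
    simp only [ideal]
    rw [ketbra, Matrix.trace_vecMulVec]
    simp [idealVec₀, dotProduct, Fin.sum_univ_three]
  isHermitian i := ketbra_isHermitian _
  idempotent i := by
    simp only [ideal]
    rw [ketbra_mul_ketbra, star_idealVec_dotProduct_self hN, one_smul, ketbra]
  compatible i := (ideal_mul_finRotate hN hodd i).trans (ideal_finRotate_mul hN hodd i).symm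

theorem ideal_trace_P_mul {N : ℕ} (hN : 5 ≤ N) (i : Fin N) :
    ((ideal N).P i * (ideal N).ρ).trace = (cosSq N : ℂ) := by
  obtain ⟨h0, h1⟩ := cosSq_pos_and_lt_one hN
  have hs0 : √(cosSq N) * √(cosSq N) = cosSq N := Real.mul_self_sqrt h0.le
  simp only [ideal]
  rw [ketbra_mul_ketbra, Matrix.trace_smul, Matrix.trace_vecMulVec]
  simp [idealVec, idealVec₀, dotProduct, Fin.sum_univ_three, ← Complex.ofReal_mul, hs0]

/-- The probability of outcome `a` in the ideal strategy, which is the same for all measurements. -/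
noncomputable def idealProb (N : ℕ) (a : Fin 2) : ℝ := if a = 1 then cosSq N else 1 - cosSq N

theorem ideal_trace_M_mul {N : ℕ} (hN : 5 ≤ N) (hodd : Odd N) (a : Fin 2) (i : Fin N) :
    ((ideal N).M a i * (ideal N).ρ).trace = (idealProb N a : ℂ) := by
  unfold Strategy.M idealProb
  split_ifs
  · exact ideal_trace_P_mul hN i
  · rw [Matrix.sub_mul, Matrix.one_mul, Matrix.trace_sub, ideal_trace_P_mul hN,
      (ideal_isQuantum hN hodd).trace_eq_one]
    simp

theorem ideal_prob {N : ℕ} (hN : 5 ≤ N) (hodd : Odd N) (a : Fin 2) (i : Fin N) :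
    (ideal N).prob a i = idealProb N a := by
  rw [Strategy.prob, ideal_trace_M_mul hN hodd, Complex.ofReal_re]

theorem idealProb_pos {N : ℕ} (hN : 5 ≤ N) (a : Fin 2) : 0 < idealProb N a := by
  obtain ⟨h0, h1⟩ := cosSq_pos_and_lt_one hN
  unfold idealProb
  split_ifs <;> linarith

theorem ideal_beta {N : ℕ} (hN : 5 ≤ N) (hodd : Odd N) : (ideal N).beta = N * cosSq N := by
  have hterm (i : Fin N) : (ideal N).prob₂ 1 0 i (finRotate N i) = cosSq N := by
    simp only [Strategy.prob₂, Strategy.M, if_true, zero_ne_one, if_false]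
    rw [Matrix.sub_mul, Matrix.one_mul, ← Matrix.mul_assoc, ← Matrix.mul_assoc,
      ideal_finRotate_mul hN hodd, Matrix.zero_mul, Matrix.zero_mul, sub_zero,
      Matrix.trace_mul_comm, ← Matrix.mul_assoc, (ideal_isQuantum hN hodd).idempotent,
      ideal_trace_P_mul hN, Complex.ofReal_re]
  rw [Strategy.beta, Finset.sum_congr rfl fun i _ => hterm i]
  simp

theorem le_betaQT {N : ℕ} (hN : 5 ≤ N) (hodd : Odd N) : N * cosSq N ≤ betaQT N := by
  refine le_csSup ⟨N * cosSq N, ?_⟩ ⟨3, ideal N, ideal_isQuantum hN hodd, ideal_beta hN hodd⟩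
  rintro b ⟨d, S, hS, rfl⟩
  exact hS.beta_le hodd hN

theorem ideal_post_eq_ketbra {N : ℕ} (hN : 5 ≤ N) (hodd : Odd N) (a : Fin 2) (i : Fin N) :
    ∃ k : Fin 3 → ℂ, star k ⬝ᵥ k = 1 ∧ (ideal N).post a i = ketbra k := by
  have hS := ideal_isQuantum hN hodd
  have hp := idealProb_pos hN a
  have hMH : ((ideal N).M a i)ᴴ = (ideal N).M a i := by
    unfold Strategy.M
    split_ifs <;> simp [(hS.isHermitian i).eq]
  have hMM : (ideal N).M a i * (ideal N).M a i = (ideal N).M a i := by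
    unfold Strategy.M
    split_ifs
    · exact hS.idempotent i
    · rw [Matrix.mul_sub, Matrix.mul_one, Matrix.sub_mul, hS.idempotent]; simp
  have htr := ideal_trace_M_mul hN hodd a i
  set T := (ideal N).M a i
  set p := idealProb N a with hpd
  have hsq : (√p)⁻¹ * (√p)⁻¹ = p⁻¹ := by
    rw [← mul_inv, Real.mul_self_sqrt hp.le]
  have hstar : star (T *ᵥ idealVec₀) = star idealVec₀ ᵥ* T := by
    rw [Matrix.star_mulVec, hMH]
  refine ⟨(√p)⁻¹ • (T *ᵥ idealVec₀), ?_, ?_⟩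
  · have h1 : star idealVec₀ ⬝ᵥ (T *ᵥ idealVec₀) = (p : ℂ) := by
      rw [← htr]
      change _ = (T * ketbra idealVec₀).trace
      rw [ketbra, Matrix.mul_vecMulVec, Matrix.trace_vecMulVec, dotProduct_comm]
    rw [star_smul, star_trivial (√p)⁻¹, smul_dotProduct, dotProduct_smul, smul_smul, hsq, hstar,
      ← Matrix.dotProduct_mulVec, Matrix.mulVec_mulVec, hMM, h1, Complex.real_smul,
      ← Complex.ofReal_mul, inv_mul_cancel₀ hp.ne', Complex.ofReal_one]
  · rw [Strategy.post, ideal_prob hN hodd, ← hpd]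
    change p⁻¹ • (T * ketbra idealVec₀ * T) = _
    rw [ketbra, ketbra, star_smul, star_trivial (√p)⁻¹, Matrix.smul_vecMulVec,
      Matrix.vecMulVec_smul, smul_smul, hsq, hstar, Matrix.mul_vecMulVec, Matrix.vecMulVec_mul]

/-! ### Eve's conditional states -/

/-- Eve's conditional state is a transpose: with `Ψ` the matrix of `ψ`, it equals `(Ψᴴ M Ψ)ᵀ`. -/
theorem eveState_eq {N dA dE : ℕ} (S : Strategy N dA) (ψ : Fin dA × Fin dE → ℂ) (a : Fin 2)
    (i : Fin N) : eveState S ψ a i =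
      ((Matrix.of fun x k => ψ (x, k))ᴴ * (S.M a i * Matrix.of fun x k => ψ (x, k)))ᵀ := by
  ext k l
  simp only [eveState, traceFst, ketbra, Matrix.of_apply, Matrix.mul_apply,
    Matrix.kroneckerMap_apply, Fintype.sum_prod_type, Matrix.vecMulVec_apply, Matrix.one_apply,
    Matrix.transpose_apply, Matrix.conjTranspose_apply, Pi.star_apply, Finset.mul_sum]
  refine Finset.sum_congr rfl fun x _ => Finset.sum_congr rfl fun y _ => ?_
  simp
  ring

section

variable {n ι : Type*} [Fintype n] [Fintype ι] (F : Matrix n ι ℂ) {A A₀ R : Matrix n n ℂ}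
  {κ w δ : ℝ}

/-- If `A` and `A₀` are both close to `κ R`, then `A` is close to `κ` times the normalization
`w⁻¹ A₀`, where `w ≈ κ` stands for the trace of `A₀`. -/
theorem frameNorm_sub_rescaled_le (hA : frameNorm F (A - κ • R) ≤ δ)
    (hA₀ : frameNorm F (A₀ - κ • R) ≤ δ) (hw : 0 < w) (hA₀w : frameNorm F A₀ ≤ w)
    (hwκ : |w - κ| ≤ δ) : frameNorm F (A - κ • w⁻¹ • A₀) ≤ 3 * δ := by
  have hs : frameNorm F ((1 - κ * w⁻¹) • A₀) ≤ δ := by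
    rw [frameNorm_smul, show 1 - κ * w⁻¹ = (w - κ) / w by field_simp, abs_div, abs_of_pos hw,
      div_mul_eq_mul_div, div_le_iff₀ hw]
    exact mul_le_mul hwκ hA₀w (frameNorm_nonneg F _) ((abs_nonneg _).trans hwκ)
  have : A - κ • w⁻¹ • A₀ = (A - κ • R) - (A₀ - κ • R) + (1 - κ * w⁻¹) • A₀ := by
    module
  rw [this]
  linarith [frameNorm_add_le F ((A - κ • R) - (A₀ - κ • R)) ((1 - κ * w⁻¹) • A₀),
    frameNorm_sub_le F (A - κ • R) (A₀ - κ • R)]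

/-- If `A` and `A₀` are both close to `κ R`, then `R - A` is close to `1 - κ` times the
normalization `w⁻¹ A₀`, where `w ≈ κ` stands for the trace of `A₀`. -/
theorem frameNorm_sub_sub_rescaled_le (hA : frameNorm F (A - κ • R) ≤ δ)
    (hA₀ : frameNorm F (A₀ - κ • R) ≤ δ) (hw : 0 < w) (hκ : 0 < κ) (hA₀w : frameNorm F A₀ ≤ w)
    (hwκ : |w - κ| ≤ δ) :
    frameNorm F (R - A - (1 - κ) • w⁻¹ • A₀) ≤ (3 + 4 / κ) * δ := by
  have h1 := frameNorm_sub_rescaled_le F hA hA₀ hw hA₀w hwκ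
  have h2 := frameNorm_sub_rescaled_le F hA₀ hA₀ hw hA₀w hwκ
  have h3 : R - A - (1 - κ) • w⁻¹ • A₀ =
      κ⁻¹ • ((A₀ - κ • w⁻¹ • A₀) - (A₀ - κ • R)) - (A - κ • w⁻¹ • A₀) := by
    have e : κ⁻¹ • ((A₀ - κ • w⁻¹ • A₀) - (A₀ - κ • R)) = R - w⁻¹ • A₀ := by
      rw [inv_smul_eq_iff₀ hκ.ne']
      module
    rw [e]
    module
  rw [h3]
  refine (frameNorm_sub_le F _ _).trans ?_
  rw [frameNorm_smul, abs_of_pos (inv_pos.2 hκ)]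
  have h4 := frameNorm_sub_le F (A₀ - κ • w⁻¹ • A₀) (A₀ - κ • R)
  have h5 : κ⁻¹ * frameNorm F ((A₀ - κ • w⁻¹ • A₀) - (A₀ - κ • R)) ≤ κ⁻¹ * (4 * δ) :=
    mul_le_mul_of_nonneg_left (by linarith) (inv_pos.2 hκ).le
  calc _ ≤ κ⁻¹ * (4 * δ) + 3 * δ := by linarith
    _ = _ := by ring

end

open scoped Matrix.Norms.Frobenius in
/-- Rigidity for strategies: near the maximal value, the operator `Ψᴴ Q Ψ` of every edge projection
`Q` is close to `κ Ψᴴ Ψ`. -/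
theorem Strategy.IsQuantum.frameNorm_sub_cosSq_smul_le {N d : ℕ} (hodd : Odd N) (hN : 5 ≤ N)
    {S : Strategy N d} (hS : S.IsQuantum) {ε : ℝ} (hε : 0 ≤ ε) (hβ : S.beta = betaQT N - ε)
    {n : Type*} [Fintype n] [DecidableEq n] {Ψ : Matrix (Fin d) n ℂ} (hΨ : Ψ * Ψᴴ = S.ρ)
    {ι : Type*} [Fintype ι] {F : Matrix n ι ℂ} (hF : F * Fᴴ = 1) (i : Fin N) :
    frameNorm F (Ψᴴ * (S.edgeProj i * Ψ) - cosSq N • (Ψᴴ * Ψ)) ≤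
      (20 * N / (2 * Real.cos (Real.pi / N) - 1) + 5) * √ε := by
  have : NeZero N := ⟨by omega⟩
  have h := hS.isCycleProj.frameNorm_sub_cosSq_smul_le hodd hN
    (norm_purification hS.trace_eq_one hΨ) hε
    (by rw [← hS.beta_eq_cycleValue hΨ, hβ]; linarith [le_betaQT hN hodd]) hF
    (ZMod.finEquiv N i)
  simpa only [cycleProj, RingEquiv.symm_apply_apply] using h

theorem conjTranspose_mul_ketbra_mul {m n : Type*} [Fintype m] (Ψ : Matrix m n ℂ) (v : m → ℂ) :
    Ψᴴ * (ketbra v * Ψ) = ketbra (Ψᴴ *ᵥ v) := by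
  rw [ketbra, ketbra, Matrix.vecMulVec_mul, Matrix.mul_vecMulVec, Matrix.star_mulVec,
    Matrix.conjTranspose_conjTranspose]

theorem exists_unit_ketbra {n : Type*} [Fintype n] {g : n → ℂ} {w : ℝ} (hw : 0 < w)
    (hg : star g ⬝ᵥ g = w) :
    ∃ ξ : n → ℂ, star ξ ⬝ᵥ ξ = 1 ∧ ketbra ξ = (w⁻¹ • ketbra g)ᵀ := by
  have hsq : (√w)⁻¹ * (√w)⁻¹ = w⁻¹ := by
    rw [← mul_inv, Real.mul_self_sqrt hw.le]
  refine ⟨(√w)⁻¹ • star g, ?_, ?_⟩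
  · rw [star_smul, star_trivial (√w)⁻¹, smul_dotProduct, dotProduct_smul, smul_smul, hsq, star_star,
      dotProduct_comm, hg, Complex.real_smul, ← Complex.ofReal_mul, inv_mul_cancel₀ hw.ne',
      Complex.ofReal_one]
  · ext x y
    have hsq' : ((√w : ℂ))⁻¹ * (√w : ℂ)⁻¹ = (w : ℂ)⁻¹ := by exact_mod_cast hsq
    simp [ketbra, Matrix.vecMulVec_apply]
    linear_combination (starRingEnd ℂ (g x) * g y) * hsq'

end Cycle

open scoped Matrix.Norms.Frobenius in
theorem theorem2 (N : ℕ) (hN : 5 ≤ N) (hodd : Odd N) :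
    ∃ C : ℝ, 0 < C ∧ ∃ ε₀ : ℝ, 0 < ε₀ ∧
      ∀ ε : ℝ, 0 ≤ ε → ε ≤ ε₀ →
      ∀ (dA dE : ℕ) (S : Cycle.Strategy N dA), S.IsQuantum → S.IsRankOne →
      S.beta = Cycle.betaQT N - ε →
      ∀ ψ : Fin dA × Fin dE → ℂ, Cycle.traceSnd (Cycle.ketbra ψ) = S.ρ →
      ∃ ξ : Fin dE → ℂ, star ξ ⬝ᵥ ξ = 1 ∧
        ∀ i : Fin N,
          Cycle.traceNorm (Cycle.postState S ψ i - Cycle.productState N ξ i) ≤ C * √ε := by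
  obtain ⟨hκ0, hκ1⟩ := Cycle.cosSq_pos_and_lt_one hN
  have hc := Cycle.half_lt_cos_pi_div hN
  set c := Real.cos (Real.pi / N)
  set κ := Cycle.cosSq N
  set C₁ : ℝ := 20 * N / (2 * c - 1) + 5
  have h2c : 0 < 2 * c - 1 := by linarith
  have hC₁0 : 0 < C₁ := by positivity
  -- The choice of `ε₀` makes the rigidity error `δ = C₁ √ε` at most `κ / 2`.
  refine ⟨(6 + 4 / κ) * C₁, by positivity, (κ / (2 * C₁)) ^ 2, by positivity, ?_⟩
  intro ε hε hε₀ dA dE S hS hR hβ ψ hψ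
  set δ := C₁ * √ε with hδd
  have hδ : δ ≤ κ / 2 := by
    have h1 : √ε ≤ κ / (2 * C₁) := Real.sqrt_le_iff.2 ⟨by positivity, hε₀⟩
    calc δ ≤ C₁ * (κ / (2 * C₁)) := mul_le_mul_of_nonneg_left h1 hC₁0.le
      _ = κ / 2 := by field_simp
  set Ψ : Matrix (Fin dA) (Fin dE) ℂ := Matrix.of fun x k => ψ (x, k) with hΨd
  have hΨ : Ψ * Ψᴴ = S.ρ := by
    rw [← hψ]
    ext x y
    simp [Ψ, Matrix.mul_apply, Cycle.traceSnd, Cycle.ketbra, Matrix.vecMulVec_apply]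
  have hnorm : ‖Ψ‖ = 1 := Cycle.Strategy.norm_purification hS.trace_eq_one hΨ
  have hRtr : (Ψᴴ * Ψ).trace = 1 := by
    rw [Cycle.trace_conjTranspose_mul_self, hnorm]; simp
  have hedge (i : Fin N) {ι : Type} [Fintype ι] {F : Matrix (Fin dE) ι ℂ} (hF : F * Fᴴ = 1) :
      Cycle.frameNorm F (Ψᴴ * (S.edgeProj i * Ψ) - κ • (Ψᴴ * Ψ)) ≤ δ :=
    hS.frameNorm_sub_cosSq_smul_le hodd hN hε hβ hΨ hF i
  have htrace (i : Fin N) : ‖(Ψᴴ * (S.edgeProj i * Ψ)).trace - κ‖ ≤ δ := by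
    have h := (Cycle.norm_trace_le_frameNorm _).trans (hedge i (F := 1) (by simp))
    rwa [Matrix.trace_sub, Matrix.trace_smul, hRtr, Complex.real_smul, mul_one] at h
  -- Equal neighbouring projections would make the edge projection vanish, against `htrace`.
  have hP (i : Fin N) : S.edgeProj i = S.P i := by
    obtain ⟨v, hv, hPv⟩ := hR i
    have hcomm := hS.compatible i
    have h := htrace i
    rw [Cycle.Strategy.edgeProj]
    rw [hPv] at hcomm ⊢
    refine (Cycle.mul_one_sub_eq_zero_or hv (hS.idempotent _) hcomm).resolve_left fun h0 => ?_
    rw [Cycle.Strategy.edgeProj, hPv, h0] at h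
    simp only [Matrix.zero_mul, Matrix.mul_zero, Matrix.trace_zero, zero_sub, norm_neg,
      Complex.norm_real, Real.norm_of_nonneg hκ0.le] at h
    linarith
  simp only [hP] at hedge htrace
  set i₀ : Fin N := ⟨0, by omega⟩
  obtain ⟨v, hv, hPv⟩ := hR i₀
  set A₀ := Ψᴴ * (S.P i₀ * Ψ) with hA₀
  have hA₀g : A₀ = Cycle.ketbra (Ψᴴ *ᵥ v) := by
    rw [hA₀, hPv, Cycle.conjTranspose_mul_ketbra_mul]
  have hA₀sq : A₀ = (S.P i₀ * Ψ)ᴴ * (S.P i₀ * Ψ) := by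
    rw [Matrix.conjTranspose_mul, (hS.isHermitian _).eq, Matrix.mul_assoc,
      ← Matrix.mul_assoc (S.P i₀), hS.idempotent]
  set w := ‖S.P i₀ * Ψ‖ ^ 2 with hwd
  have hA₀tr : A₀.trace = (w : ℂ) := by rw [hA₀sq, Cycle.trace_conjTranspose_mul_self]
  have hwκ : |w - κ| ≤ δ := by
    have h := htrace i₀
    rwa [← hA₀, hA₀tr, ← Complex.ofReal_sub, Complex.norm_real] at h
  have hw : 0 < w := by linarith [(abs_le.1 hwκ).1]
  have hA₀w {ι : Type} [Fintype ι] {F : Matrix (Fin dE) ι ℂ} (hF : F * Fᴴ = 1) :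
      Cycle.frameNorm F A₀ ≤ w := by
    rw [hA₀sq, hwd, sq]
    exact Cycle.frameNorm_conjTranspose_mul_le hF _ _
  -- The normalized state of Eve for the outcome `1` of the measurement `i₀` serves as `|ξ⟩⟨ξ|`.
  obtain ⟨ξ, hξ, hξA⟩ := Cycle.exists_unit_ketbra (g := Ψᴴ *ᵥ v) hw (by
    rw [← hA₀tr, hA₀g, Cycle.ketbra, Matrix.trace_vecMulVec, dotProduct_comm])
  rw [← hA₀g] at hξA
  refine ⟨ξ, hξ, fun i => ?_⟩
  choose k hk hpost using fun a => Cycle.ideal_post_eq_ketbra hN hodd a i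
  set B : Fin 2 → Matrix (Fin dE) (Fin dE) ℂ := fun a =>
    Ψᴴ * (S.M a i * Ψ) - Cycle.idealProb N a • w⁻¹ • A₀ with hB
  have hdiff : Cycle.postState S ψ i - Cycle.productState N ξ i =
      ∑ a, Cycle.ketbra (k a) ⊗ₖ (B a)ᵀ := by
    ext ⟨p, x⟩ ⟨q, y⟩
    simp only [Cycle.postState, Cycle.productState, Cycle.eveState_eq, hpost, hξA,
      Cycle.ideal_prob hN hodd, Fin.sum_univ_two, Matrix.sub_apply, Matrix.add_apply,
      Matrix.kroneckerMap_apply, Matrix.transpose_apply, Matrix.smul_apply, hB, ← hΨd]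
    simp only [Complex.real_smul]
    ring
  have hBH (a : Fin 2) : (B a).IsHermitian := by
    have hMH : (S.M a i)ᴴ = S.M a i := by
      unfold Cycle.Strategy.M
      split_ifs <;> simp [(hS.isHermitian i).eq]
    have hA₀H : A₀ᴴ = A₀ := by rw [hA₀g]; exact Cycle.ketbra_isHermitian _
    rw [Matrix.IsHermitian, hB]
    simp only [Matrix.conjTranspose_sub, Matrix.conjTranspose_smul, Matrix.conjTranspose_mul,
      Matrix.conjTranspose_conjTranspose, hMH, hA₀H, star_trivial, Matrix.mul_assoc]
  -- Outcome `0` corresponds to `Ψᴴ Ψ - Ψᴴ P Ψ`, outcome `1` to `Ψᴴ P Ψ`.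
  have hle := Cycle.traceNorm_sum_ketbra_kronecker_le hk hBH (b := ![(3 + 4 / κ) * δ, 3 * δ])
    fun a F hF => by
      fin_cases a
      · have h := Cycle.frameNorm_sub_sub_rescaled_le F (hedge i hF) (hedge i₀ hF) hw hκ0
          (hA₀w hF) hwκ
        simpa [hB, Cycle.Strategy.M, Cycle.idealProb, Matrix.sub_mul, Matrix.mul_sub] using h
      · have h := Cycle.frameNorm_sub_rescaled_le F (hedge i hF) (hedge i₀ hF) hw
          (hA₀w hF) hwκ
        simpa [hB, Cycle.Strategy.M, Cycle.idealProb] using h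
  rw [hdiff]
  refine hle.trans_eq ?_
  simp only [Fin.sum_univ_two, Matrix.cons_val_zero, Matrix.cons_val_one, hδd]
  ring
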